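/- Let $\mathcal B$ be the Borel $\sigma$-algebra and $\mu$ Lebesgue measure on $[0,1]$, and let $\mathrm{Aut}([0,1],\mathcal B,\mu)$ be the group of invertible measure preserving transformations of $[0,1]$ (identified when they agree $\mu$-almost everywhere), endowed with the weak topology, in which $T_n\to T$ if and only if $\|f\circ T_n-f\circ T\|_{L^2(\mu)}\to 0$ for every $f\in L^2(\mu)$. Call $T$ aperiodic if the set of $x\in[0,1]$ for which $T^m x=x$ for some integer $m\ge 1$ has measure zero. Let $N\in\mathbb N$, let $\lambda_1,\dots,\lambda_N\in[0,1]$ and let $\phi_1,\dots,\phi_N:\mathbb N\to\mathbb Z$. Suppose that $\phi_1,\dots,\phi_N$ satisfy the following condition, witnessed by a sequence $(n_k)_{k\in\mathbb N}$. Condition C: there exists a strictly increasing sequence $(n_k)_{k\in\mathbb N}$ in $\mathbb N$ such that for every $\xi=(\xi_1,\dots,\xi_N)\in\{0,1\}^N$ there is an aperiodic $T_\xi\in\mathrm{Aut}([0,1],\mathcal B,\mu)$ such that for every $j\in\{1,\dots,N\}$ and all $A,B\in\mathcal B$, $$\lim_{k\to\infty}\mu\bigl(A\cap T_\xi^{-\phi_j(n_k)}B\bigr)=(1-\xi_j)\,\mu(A\cap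 B)+\xi_j\,\mu(A)\mu(B).$$ Then the set of all $T\in\mathrm{Aut}([0,1],\mathcal B,\mu)$ for which there exists a strictly increasing sequence $(k_\ell)_{\ell\in\mathbb N}$ in $\mathbb N$ such that for every $j\in\{1,\dots,N\}$ and all $A,B\in\mathcal B$, $$\lim_{\ell\to\infty}\mu\bigl(A\cap T^{-\phi_j(n_{k_\ell})}B\bigr)=(1-\lambda_j)\,\mu(A\cap B)+\lambda_j\,\mu(A)\mu(B),$$ is a dense $G_\delta$ subset of $\mathrm{Aut}([0,1],\mathcal B,\mu)$. -/

import Mathlib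

open MeasureTheory Filter Topology unitInterval

noncomputable section

/-- The group (under composition) of invertible, bi-measurable, Lebesgue measure preserving maps of
`[0,1]` onto itself, as honest pointwise maps. Here `I = [0,1]` carries its Borel σ-algebra and
`volume`, which is Lebesgue measure on `[0,1]`. -/
def mpSubgroup : Subgroup (Equiv.Perm I) where
  carrier := {T | MeasurePreserving (T : I → I) volume volume ∧
    MeasurePreserving (T.symm : I → I) volume volume}
  mul_mem' := fun {_ _} hS hT => ⟨hS.1.comp hT.1, hT.2.comp hS.2⟩
  one_mem' := ⟨MeasurePreserving.id _, MeasurePreserving.id _⟩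
  inv_mem' := fun {_} hT => ⟨hT.2, hT.1⟩

/-- The type of invertible Lebesgue measure preserving maps of `[0,1]`. -/
def MPMap : Type := mpSubgroup

namespace MPMap

instance : Group MPMap := inferInstanceAs (Group mpSubgroup)

/-- The underlying map `[0,1] → [0,1]`. -/
def toFun (T : MPMap) : I → I := (T.1 : Equiv.Perm I)

theorem measurePreserving (T : MPMap) : MeasurePreserving T.toFun volume volume := T.2.1

/-- Almost everywhere equality, as a congruence on the group of measure preserving maps. -/
def aeCon : Con MPMap where
  r S T := S.toFun =ᵐ[volume] T.toFun
  iseqv := ⟨fun _ => ae_eq_refl _, fun h => h.symm, fun h h' => h.trans h'⟩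
  mul' := by
    intro S S' T T' hS hT
    have h1 : S.toFun ∘ T.toFun =ᵐ[volume] S'.toFun ∘ T.toFun :=
      T.measurePreserving.quasiMeasurePreserving.ae_eq_comp hS
    have h2 : S'.toFun ∘ T.toFun =ᵐ[volume] S'.toFun ∘ T'.toFun := hT.fun_comp _
    exact h1.trans h2

/-- A measure preserving map is aperiodic if the set of its periodic points has measure zero. -/
def IsAperiodic (T : MPMap) : Prop :=
  volume {x : I | ∃ n : ℕ, 1 ≤ n ∧ (T ^ n).toFun x = x} = 0

theorem isAperiodic_of_ae_eq {S T : MPMap} (h : aeCon S T) (hS : S.IsAperiodic) :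
    T.IsAperiodic := by
  have hpow : ∀ᵐ x : I, ∀ n : ℕ, (S ^ n).toFun x = (T ^ n).toFun x :=
    ae_all_iff.2 fun n => aeCon.pow n h
  have hS' : ∀ᵐ x : I, ¬ ∃ n : ℕ, 1 ≤ n ∧ (S ^ n).toFun x = x := measure_eq_zero_iff_ae_notMem.1 hS
  refine measure_eq_zero_iff_ae_notMem.2 ?_
  filter_upwards [hpow, hS'] with x hx hx'
  rintro ⟨n, hn, hTx⟩
  exact hx' ⟨n, hn, (hx n).trans hTx⟩

end MPMap

/-- `Aut([0,1], 𝓑, μ)`: the group of invertible Lebesgue measure preserving transformations of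
`[0,1]`, two transformations being identified when they agree almost everywhere. -/
def Aut01 : Type := MPMap.aeCon.Quotient

namespace Aut01

instance : Group Aut01 := inferInstanceAs (Group MPMap.aeCon.Quotient)

/-- The class of a measure preserving map. -/
def mk : MPMap →* Aut01 := MPMap.aeCon.mk'

/-- The Koopman operator `f ↦ f ∘ T` on `L²([0,1])`. -/
def koopman (T : Aut01) : Lp ℝ 2 (volume : Measure I) → Lp ℝ 2 (volume : Measure I) :=
  Quotient.liftOn T (fun S f => Lp.compMeasurePreserving S.toFun S.measurePreserving f) (by
    intro S S' h
    funext f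
    refine Lp.ext ?_
    have h' : f ∘ S.toFun =ᵐ[volume] f ∘ S'.toFun := EventuallyEq.fun_comp (show S.toFun =ᵐ[volume] S'.toFun from h) _
    exact ((Lp.coeFn_compMeasurePreserving f S.measurePreserving).trans h').trans
      (Lp.coeFn_compMeasurePreserving f S'.measurePreserving).symm)

/-- The weak topology on `Aut([0,1], 𝓑, μ)`: `Tₙ → T` if and only if `‖Tₙ f - T f‖₂ → 0` for every
`f ∈ L²`. -/
instance : TopologicalSpace Aut01 := TopologicalSpace.induced koopman inferInstance

/-- Aperiodicity (which does not depend on the representative). -/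
def IsAperiodic (T : Aut01) : Prop :=
  Quotient.liftOn T MPMap.IsAperiodic fun _ _ h => propext
    ⟨MPMap.isAperiodic_of_ae_eq h, MPMap.isAperiodic_of_ae_eq (MPMap.aeCon.symm h)⟩

/-- `μ(A ∩ T⁻¹ B)` (which does not depend on the representative). -/
def interMeasure (T : Aut01) (A B : Set I) : ℝ :=
  Quotient.liftOn T (fun S => volume.real (A ∩ S.toFun ⁻¹' B)) (by
    intro S S' h
    refine measureReal_congr ?_
    have h' : S.toFun ⁻¹' B =ᵐ[volume] S'.toFun ⁻¹' B := 
      EventuallyEq.fun_comp (show S.toFun =ᵐ[volume] S'.toFun from h) B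
    exact (ae_eq_refl A).inter h')

/-- For all Borel `A, B ⊆ [0,1]`:
`lim_k μ(A ∩ T^{-m k} B) = (1 - c) μ(A ∩ B) + c μ(A) μ(B)`.
(`T^{-m} B` is the preimage of `B` under `T^m`.) Rigidity along `m` is `c = 0`, mixing along `m` is
`c = 1`. -/
def HasLimitAlong (T : Aut01) (m : ℕ → ℤ) (c : ℝ) : Prop :=
  ∀ A B : Set I, MeasurableSet A → MeasurableSet B →
    Tendsto (fun k => (T ^ m k).interMeasure A B) atTop
      (𝓝 ((1 - c) * volume.real (A ∩ B) + c * (volume.real A * volume.real B)))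

end Aut01

/-- The sequence `n` witnesses Condition C for `φ₁, …, φ_N`: it is strictly increasing, and for each
`ξ ∈ {0,1}^N` some aperiodic `T` satisfies, for each `j` and all Borel `A, B`,
`lim_k μ(A ∩ T^{-φ_j(n_k)} B) = (1 - ξ_j) μ(A ∩ B) + ξ_j μ(A) μ(B)`. -/
def ConditionC {N : ℕ} (φ : Fin N → ℕ → ℤ) (n : ℕ → ℕ) : Prop :=
  StrictMono n ∧
    ∀ ξ : Fin N → ℝ, (∀ j, ξ j = 0 ∨ ξ j = 1) →
      ∃ T : Aut01, T.IsAperiodic ∧ ∀ j, T.HasLimitAlong (fun k => φ j (n k)) (ξ j)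

/-- The set of `T ∈ Aut([0,1], 𝓑, μ)` for which there is a strictly increasing sequence `(k_l)` with
`lim_l μ(A ∩ T^{-φ_j(n_{k_l})} B) = (1 - λ_j) μ(A ∩ B) + λ_j μ(A) μ(B)` for each `j` and all Borel
`A, B`. -/
def interpolationSet {N : ℕ} (φ : Fin N → ℕ → ℤ) (n : ℕ → ℕ) (lam : Fin N → ℝ) : Set Aut01 :=
  {T | ∃ k : ℕ → ℕ, StrictMono k ∧ ∀ j, T.HasLimitAlong (fun l => φ j (n (k l))) (lam j)}

end

/-! The interpolation set is a countable intersection of open sets. Both `μ(A ∩ T⁻¹B)` and the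
prescribed limit are Lipschitz in `A` and `B` for the measure of the symmetric difference, so a
dense sequence of Borel sets suffices, and a diagonal choice of times turns approximate behaviour at
arbitrarily late times into a limit (`interpolationSet_eq_iInter`). The group embeds as a closed
subset of `L² × L²` through the images of the coordinate function under `T` and `T⁻¹`
(`isInducing_toLpProd`, `isClosed_range_toLpProd`), hence is a Baire space. What remains is density
of each open set.

Given `S₀` and finitely many sets, a transformation close to `S₀` on these sets is built with
exactly the required limits on them (`exists_close_tendsto_mixLimit`). Condition C supplies for each
`ξ` an aperiodic `V ξ` that is rigid or mixing along each `φ j`. Rokhlin towers make any two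
aperiodic systems nearly equal after conjugation (`exists_conj_close`), so a copy of `V ξ` on the
square imitates `S₀` on the first coordinate, while conjugation leaves its limits unchanged. Over a
parameter `θ ∈ [0,1]` the copy with `ξ j = 1` exactly when `θ < lam j` is run. Integration over `θ`
averages the limits, with weight `lam j` on mixing, and the average of imitations of `S₀` still
imitates `S₀`. An isomorphism of the cube with `[0,1]` that respects the finitely many sets brings
the result back. -/

noncomputable section

/-! ### Almost everywhere injective maps between standard Borel spaces -/

section StandardBorel

variable {X Y : Type*} [MeasurableSpace X] [StandardBorelSpace X] [MeasurableSpace Y]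
  [StandardBorelSpace Y] {μ : Measure X} {ν : Measure Y}

/-- In a Borel copy of the plane the vertical lines are uncountably many disjoint uncountable sets,
and only countably many of them can have positive measure. -/
theorem exists_null_measurableSet_not_countable (μ : Measure X) [IsProbabilityMeasure μ]
    [NullSingletonClass μ] : ∃ Z : Set X, MeasurableSet Z ∧ μ Z = 0 ∧ ¬ Z.Countable := by
  have hX : ¬ Countable X := fun h => by
    have := Set.countable_univ (α := X) |>.measure_zero μ
    simp at this
  have hR : ¬ Countable (ℝ × ℝ) := fun h => by
    have : Countable ℝ := (Prod.mk_right_injective (0 : ℝ)).countable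
    exact Cardinal.not_countable_real (Set.countable_univ)
  let e : X ≃ᵐ ℝ × ℝ := PolishSpace.measurableEquivOfNotCountable hX hR
  let A : ℝ → Set X := fun a => e ⁻¹' (Prod.fst ⁻¹' {a})
  have hA : ∀ a, MeasurableSet (A a) := fun a =>
    e.measurable (measurable_fst (measurableSet_singleton a))
  have hd : Pairwise (Function.onFun Disjoint A) := by
    intro a b hab
    refine Set.disjoint_left.2 fun x hx hx' => hab ?_
    exact (Eq.symm hx).trans hx'
  have hc := Measure.countable_meas_pos_of_disjoint_iUnion (μ := μ) hA hd
  obtain ⟨a, ha⟩ : ∃ a, a ∉ {i | 0 < μ (A i)} := by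
    by_contra! h
    exact Cardinal.not_countable_real (hc.mono fun x _ => h x)
  refine ⟨A a, hA a, by simpa using ha, fun h => ?_⟩
  have h2 := (h.image e).image Prod.snd
  refine Cardinal.not_countable_real (h2.mono fun y _ => ?_)
  exact ⟨(a, y), ⟨e.symm (a, y), by simp [A], by simp⟩, rfl⟩

/-- A measure preserving map which is injective almost everywhere agrees almost everywhere with an
isomorphism. -/
theorem MeasureTheory.MeasurePreserving.exists_measurableEquiv_ae_eq [IsProbabilityMeasure μ]
    [IsProbabilityMeasure ν] [NullSingletonClass μ] [NullSingletonClass ν] {g : X → Y}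
    (hg : MeasurePreserving g μ ν)
    {C : Set X} (hC : ∀ᵐ x ∂μ, x ∈ C) (hinj : Set.InjOn g C) :
    ∃ e : X ≃ᵐ Y, MeasurePreserving e μ ν ∧ ∀ᵐ x ∂μ, e x = g x := by
  classical
  obtain ⟨Z, hZ, hZ0, hZc⟩ := exists_null_measurableSet_not_countable μ
  obtain ⟨W, hW, hW0, hWc⟩ := exists_null_measurableSet_not_countable ν
  -- Discarding `Z` and the preimage of `W` keeps both `D` conull and the complements of `D` and `g
  -- '' D` uncountable, so these leftovers are Borel isomorphic.
  let D : Set X := ((toMeasurable μ Cᶜ)ᶜ \ Z) \ g ⁻¹' W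
  have hDm : MeasurableSet D :=
    ((measurableSet_toMeasurable _ _).compl.diff hZ).diff (hg.measurable hW)
  have hDC : D ⊆ C := fun x hx => by
    by_contra h
    exact hx.1.1 (subset_toMeasurable μ Cᶜ h)
  have hDae : ∀ᵐ x ∂μ, x ∈ D := by
    have h1 : μ (toMeasurable μ Cᶜ) = 0 := by rw [measure_toMeasurable]; exact hC
    have h2 : μ (g ⁻¹' W) = 0 := by rw [hg.measure_preimage hW.nullMeasurableSet, hW0]
    filter_upwards [measure_eq_zero_iff_ae_notMem.1 h1, measure_eq_zero_iff_ae_notMem.1 hZ0,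
      measure_eq_zero_iff_ae_notMem.1 h2] with x hx1 hx2 hx3
    exact ⟨⟨hx1, hx2⟩, hx3⟩
  have hinjD : Set.InjOn g D := hinj.mono hDC
  have hgD : MeasurableSet (g '' D) := hDm.image_of_measurable_injOn hg.measurable hinjD
  have : StandardBorelSpace (Dᶜ : Set X) := hDm.compl.standardBorel
  have : StandardBorelSpace ((g '' D)ᶜ : Set Y) := hgD.compl.standardBorel
  have : StandardBorelSpace D := hDm.standardBorel
  have h1 : ¬ Countable (Dᶜ : Set X) := fun h =>
    hZc ((Set.countable_coe_iff.1 h).mono fun x hx (hxD : x ∈ D) => hxD.1.2 hx)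
  have h2 : ¬ Countable ((g '' D)ᶜ : Set Y) := fun h => by
    refine hWc ((Set.countable_coe_iff.1 h).mono ?_)
    rintro _ hx ⟨y, hy, rfl⟩
    exact hy.2 hx
  let e2 : (Dᶜ : Set X) ≃ᵐ ((g '' D)ᶜ : Set Y) := PolishSpace.measurableEquivOfNotCountable h1 h2
  let f : D → (g '' D : Set Y) := fun x => ⟨g x, x, x.2, rfl⟩
  have hf : MeasurableEmbedding f := by
    refine Measurable.measurableEmbedding ?_ ?_
    · exact (hg.measurable.comp measurable_subtype_coe).subtype_mk
    · intro x y hxy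
      exact Subtype.ext (hinjD x.2 y.2 (congrArg Subtype.val hxy))
  have hfs : Function.Surjective f := by
    rintro ⟨_, x, hx, rfl⟩
    exact ⟨⟨x, hx⟩, rfl⟩
  let e1 : D ≃ᵐ (g '' D : Set Y) :=
    { Equiv.ofBijective f ⟨hf.injective, hfs⟩ with
      measurable_toFun := hf.measurable
      measurable_invFun := by
        intro s hs
        convert hf.measurableSet_image.2 hs using 1
        exact (Equiv.image_eq_preimage_symm (Equiv.ofBijective f ⟨hf.injective, hfs⟩) s).symm }
  have he1 : ∀ x : D, (e1 x : Y) = g x := fun x => rfl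
  let e : X ≃ᵐ Y := (MeasurableEquiv.sumCompl hDm).symm.trans
    ((MeasurableEquiv.sumCongr e1 e2).trans (MeasurableEquiv.sumCompl hgD))
  have he : ∀ x ∈ D, e x = g x := by
    intro x hx
    have : (MeasurableEquiv.sumCompl hDm).symm x = Sum.inl ⟨x, hx⟩ := by
      rw [MeasurableEquiv.symm_apply_eq]; rfl
    simp only [e, MeasurableEquiv.trans_apply, this]
    exact he1 ⟨x, hx⟩
  have hae : ∀ᵐ x ∂μ, e x = g x := hDae.mono he
  exact ⟨e, ⟨e.measurable, by rw [Measure.map_congr hae, hg.map_eq]⟩, hae⟩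

end StandardBorel

/-! ### The distribution function of an atomless law -/

section Cdf

open ProbabilityTheory

theorem ProbabilityTheory.continuous_cdf (κ : Measure ℝ) [IsProbabilityMeasure κ]
    [NullSingletonClass κ] : Continuous (cdf κ) := by
  refine continuous_iff_continuousAt.2 fun a => ?_
  rw [(monotone_cdf κ).continuousAt_iff_leftLim_eq_rightLim, StieltjesFunction.rightLim_eq]
  have h := (cdf κ).measure_singleton a
  rw [measure_cdf, measure_singleton] at h
  have h1 := ENNReal.ofReal_eq_zero.1 h.symm
  exact le_antisymm ((monotone_cdf κ).leftLim_le le_rfl) (by linarith)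

/-- The cumulative distribution function with values in the unit interval. -/
def ProbabilityTheory.cdfI (κ : Measure ℝ) (x : ℝ) : I := ⟨cdf κ x, cdf_nonneg κ x, cdf_le_one κ x⟩

/-- By continuity every value in `(0,1)` is attained. A point with value `t` gives the lower bound
by monotonicity; points with values `b > t` give the upper bound as `b` decreases to `t`. -/
theorem ProbabilityTheory.measure_cdf_le (κ : Measure ℝ) [IsProbabilityMeasure κ]
    [NullSingletonClass κ] (t : I) : κ {x | cdf κ x ≤ t} = ENNReal.ofReal t := by
  have hex : ∀ s : ℝ, 0 < s → s < 1 → ∃ c, cdf κ c = s := fun s h0 h1 =>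
    mem_range_of_exists_le_of_exists_ge (continuous_cdf κ)
      (((tendsto_cdf_atBot κ).eventually (eventually_le_nhds h0)).exists)
      (((tendsto_cdf_atTop κ).eventually (eventually_ge_nhds h1)).exists)
  rcases eq_or_lt_of_le t.2.2 with h1 | h1
  · have : {x | cdf κ x ≤ t} = Set.univ := Set.eq_univ_of_forall fun x => by
      simp [h1, cdf_le_one κ x]
    rw [this, h1]; simp
  refine le_antisymm ?_ ?_
  · refine le_of_forall_gt_imp_ge_of_dense fun a ha => ?_
    rcases le_or_gt 1 a with h | h
    · exact prob_le_one.trans h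
    have ha' : a ≠ ⊤ := (h.trans ENNReal.one_lt_top).ne
    obtain ⟨b, rfl⟩ : ∃ b : ℝ, a = ENNReal.ofReal b := ⟨a.toReal, (ENNReal.ofReal_toReal ha').symm⟩
    have hb1 : b < 1 := by simpa using h
    have hb0 : (t : ℝ) < b := (ENNReal.ofReal_lt_ofReal_iff_of_nonneg t.2.1).1 ha
    obtain ⟨c, hc⟩ := hex b (t.2.1.trans_lt hb0) hb1
    rw [← hc, ofReal_cdf]
    refine measure_mono fun x hx => ?_
    by_contra hxc
    have := monotone_cdf κ (not_le.1 hxc).le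
    have hx' : cdf κ x ≤ t := hx
    linarith
  · rcases eq_or_lt_of_le t.2.1 with h0 | h0
    · rw [← h0]; simp
    obtain ⟨c, hc⟩ := hex t h0 h1
    rw [← hc, ofReal_cdf]
    exact measure_mono fun x hx => monotone_cdf κ hx

theorem ProbabilityTheory.measurePreserving_cdfI (κ : Measure ℝ) [IsProbabilityMeasure κ]
    [NullSingletonClass κ] : MeasurePreserving (cdfI κ) κ volume := by
  have hm : Measurable (cdfI κ) := (continuous_cdf κ).measurable.subtype_mk
  have : IsProbabilityMeasure (κ.map (cdfI κ)) := Measure.isProbabilityMeasure_map hm.aemeasurable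
  refine ⟨hm, Measure.ext_of_Iic _ _ fun t => ?_⟩
  rw [Measure.map_apply hm measurableSet_Iic, unitInterval.volume_Iic]
  exact measure_cdf_le κ t

/-- If two distinct points share a value, so does a rational between them. The countably many values
at rationals have a null preimage, since `cdfI` carries the law to Lebesgue measure. -/
theorem ProbabilityTheory.exists_injOn_cdfI (κ : Measure ℝ) [IsProbabilityMeasure κ]
    [NullSingletonClass κ] : ∃ C : Set ℝ, (∀ᵐ x ∂κ, x ∈ C) ∧ Set.InjOn (cdfI κ) C := by
  let N : Set I := Set.range fun q : ℚ => cdfI κ q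
  have hN : N.Countable := Set.countable_range _
  refine ⟨(cdfI κ ⁻¹' N)ᶜ, ?_, ?_⟩
  · refine measure_eq_zero_iff_ae_notMem.1 ?_
    rw [(measurePreserving_cdfI κ).measure_preimage hN.measurableSet.nullMeasurableSet]
    exact hN.measure_zero _
  · have key : ∀ x y, x ∉ cdfI κ ⁻¹' N → cdfI κ x = cdfI κ y → ¬ x < y := by
      intro x y hx hxy hlt
      obtain ⟨q, hq1, hq2⟩ := exists_rat_btwn hlt
      refine hx ⟨q, Subtype.ext (le_antisymm ?_ (monotone_cdf κ hq1.le))⟩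
      rw [hxy]
      exact monotone_cdf κ hq2.le
    intro x hx y hy hxy
    exact le_antisymm (not_lt.1 (key y x hy hxy.symm)) (not_lt.1 (key x y hx hxy))

end Cdf

/-! ### Isomorphisms respecting a discrete random variable -/

section Isomorphism

open ProbabilityTheory

variable {X Y : Type*} [MeasurableSpace X] [StandardBorelSpace X] [MeasurableSpace Y]
  [StandardBorelSpace Y] {μ : Measure X} {ν : Measure Y}

/-- An isomorphism of an atomless standard probability space with the unit interval, which arranges
the fibres of `f` in increasing order. -/
theorem exists_measurableEquiv_unitInterval [IsProbabilityMeasure μ] [NullSingletonClass μ]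
    {f : X → ℕ} (hf : Measurable f) :
    ∃ e : X ≃ᵐ I, MeasurePreserving e μ volume ∧ ∀ᵐ x ∂μ, ∀ a : ℕ,
      (f x < a → (e x : ℝ) ≤ μ.real {x | f x < a}) ∧
      (a ≤ f x → μ.real {x | f x < a} ≤ (e x : ℝ)) := by
  let w : X → ℝ := fun x => Real.sigmoid (embeddingReal X x)
  have hw : Measurable w := by
    exact Real.sigmoid_monotone.measurable.comp (measurable_embeddingReal X)
  have hwi : Function.Injective w :=
    Real.sigmoid_strictMono.injective.comp (measurableEmbedding_embeddingReal X).injective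
  have hw0 : ∀ x, 0 < w x := fun x => Real.sigmoid_pos _
  have hw1 : ∀ x, w x < 1 := fun x => Real.sigmoid_lt_one _
  -- The integer part of `h` is `f` and its fractional part is injective, so `h` is injective and
  -- orders points first by `f`; its distribution function is then the uniform coordinate.
  let h : X → ℝ := fun x => f x + w x
  have hh : Measurable h := (measurable_from_nat.comp hf).add hw
  have hlt : ∀ x (a : ℕ), h x ≤ a ↔ f x < a := by
    intro x a
    constructor
    · intro hx
      have : (f x : ℝ) < a := by have := hw0 x; simp only [h] at hx; linarith
      exact_mod_cast this
    · intro hx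
      have : (f x : ℝ) + 1 ≤ a := by exact_mod_cast hx
      have := hw1 x
      simp only [h]; linarith
  have hinj : Function.Injective h := by
    intro x y hxy
    have h1 : f x = f y := by
      refine le_antisymm ?_ ?_
      · exact Nat.lt_succ_iff.1 ((hlt x _).1 (hxy ▸ (hlt y (f y + 1)).2 (Nat.lt_succ_self _)))
      · exact Nat.lt_succ_iff.1 ((hlt y _).1 (hxy ▸ (hlt x (f x + 1)).2 (Nat.lt_succ_self _)))
    refine hwi ?_
    simpa [h, h1] using hxy
  let κ : Measure ℝ := μ.map h
  have : IsProbabilityMeasure κ := Measure.isProbabilityMeasure_map hh.aemeasurable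
  have : NullSingletonClass κ := ⟨fun a => by
    rw [Measure.map_apply hh (measurableSet_singleton a)]
    exact (Set.subsingleton_singleton.preimage hinj).measure_zero _⟩
  have hmp : MeasurePreserving h μ κ := ⟨hh, rfl⟩
  have hu := (measurePreserving_cdfI κ).comp hmp
  obtain ⟨C, hC, hCi⟩ := exists_injOn_cdfI κ
  have hC' : ∀ᵐ x ∂μ, x ∈ h ⁻¹' C := hmp.quasiMeasurePreserving.ae hC
  obtain ⟨e, he, hea⟩ := hu.exists_measurableEquiv_ae_eq hC'
    (hCi.comp hinj.injOn (Set.mapsTo_preimage _ _))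
  refine ⟨e, he, hea.mono fun x hx a => ?_⟩
  have hcdf : cdf κ a = μ.real {x | f x < a} := by
    rw [cdf_eq_real, measureReal_def, Measure.map_apply hh measurableSet_Iic, measureReal_def]
    congr 2
    ext x
    exact hlt x a
  rw [hx, ← hcdf]
  constructor
  · intro hfa
    exact monotone_cdf κ ((hlt x a).2 hfa)
  · intro hfa
    refine monotone_cdf κ (le_of_lt (not_le.1 fun hxa => ?_))
    exact absurd ((hlt x a).1 hxa) (not_lt.2 hfa)

/-- Two atomless standard probability spaces with equally distributed discrete random variables
are isomorphic in a way which respects these random variables. -/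
theorem exists_measurableEquiv_comp_ae_eq [IsProbabilityMeasure μ] [NullSingletonClass μ]
    [IsProbabilityMeasure ν] [NullSingletonClass ν] {f : X → ℕ} {g : Y → ℕ} (hf : Measurable f)
    (hg : Measurable g) (h : ∀ a, μ (f ⁻¹' {a}) = ν (g ⁻¹' {a})) :
    ∃ e : X ≃ᵐ Y, MeasurePreserving e μ ν ∧ ∀ᵐ x ∂μ, g (e x) = f x := by
  have hmap : μ.map f = ν.map g := Measure.ext_of_singleton fun a => by
    rw [Measure.map_apply hf (measurableSet_singleton a),
      Measure.map_apply hg (measurableSet_singleton a), h]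
  have hF : ∀ a : ℕ, μ.real {x | f x < a} = ν.real {y | g y < a} := by
    intro a
    have h1 := congrArg (fun m => (m (Set.Iio a)).toReal) hmap
    simp only [Measure.map_apply hf measurableSet_Iio, Measure.map_apply hg measurableSet_Iio] at h1
    exact h1
  obtain ⟨e, he, hea⟩ := exists_measurableEquiv_unitInterval (μ := μ) hf
  obtain ⟨e', he', hea'⟩ := exists_measurableEquiv_unitInterval (μ := ν) hg
  have hmp : MeasurePreserving (e.trans e'.symm) μ ν := he'.symm.comp he
  refine ⟨e.trans e'.symm, hmp, ?_⟩
  -- Both coordinates fill the same consecutive intervals level by level. Only the endpoints are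
  -- ambiguous, and they form a countable set.
  let N : Set I := (fun t : I => (t : ℝ)) ⁻¹' Set.range fun a : ℕ => μ.real {x | f x < a}
  have hN : N.Countable := (Set.countable_range _).preimage Subtype.val_injective
  have hN' : ∀ᵐ x ∂μ, e x ∉ N := he.quasiMeasurePreserving.ae (hN.ae_notMem _)
  filter_upwards [hea, hmp.quasiMeasurePreserving.ae hea', hN'] with x h1 h2 h3
  have hx : e' ((e.trans e'.symm) x) = e x := by simp
  rw [hx] at h2
  set y := (e.trans e'.symm) x
  rcases lt_trichotomy (g y) (f x) with hlt | heq | hlt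
  · refine (h3 ⟨f x, ?_⟩).elim
    have := (h1 (f x)).2 le_rfl
    have := (h2 (f x)).1 hlt
    have := hF (f x)
    simp only
    linarith
  · exact heq
  · refine (h3 ⟨g y, ?_⟩).elim
    have := (h1 (g y)).1 hlt
    have := (h2 (g y)).2 le_rfl
    have := hF (g y)
    simp only
    linarith

end Isomorphism

/-! ### Rokhlin's lemma -/

section Rokhlin

variable {X : Type*} [MeasurableSpace X] {μ : Measure X}

theorem MeasurableEquiv.symm_iterate_add (T : X ≃ᵐ X) (i j : ℕ) (x : X) :
    T.symm^[i] (T^[i + j] x) = T^[j] x := by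
  rw [Function.iterate_add_apply]
  exact (Function.LeftInverse.iterate T.symm_apply_apply i) _

theorem MeasurableEquiv.iterate_symm_add (T : X ≃ᵐ X) (i j : ℕ) (x : X) :
    T^[i] (T.symm^[i + j] x) = T.symm^[j] x := by
  rw [Function.iterate_add_apply]
  exact (Function.LeftInverse.iterate T.apply_symm_apply i) _

/-- The points whose orbit visits `S` at a time between `-N` and `N`. -/
def MeasurableEquiv.visits (T : X ≃ᵐ X) (N : ℕ) (S : Set X) : Set X :=
  {x | ∃ i ≤ N, T^[i] x ∈ S ∨ T.symm^[i] x ∈ S}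

theorem MeasurableEquiv.measurableSet_visits (T : X ≃ᵐ X) (N : ℕ) {S : Set X}
    (hS : MeasurableSet S) : MeasurableSet (T.visits N S) := by
  have : T.visits N S = ⋃ i ∈ Set.Iic N, (T^[i] ⁻¹' S ∪ T.symm^[i] ⁻¹' S) := by
    ext x; simp [visits]
  rw [this]
  refine MeasurableSet.biUnion (Set.to_countable _) fun i _ => ?_
  exact (T.measurable.iterate i hS).union (T.symm.measurable.iterate i hS)

/-- Greedy selection from the sets `E k` of points whose orbits come back late. -/
def MeasurableEquiv.greedy (T : X ≃ᵐ X) (N : ℕ) (E : ℕ → Set X) : ℕ → Set X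
  | 0 => ∅
  | k + 1 => T.greedy N E k ∪ (E k \ T.visits N (T.greedy N E k))

/-- A point of `E k` is rejected only if its orbit already meets the selection within time `N`. Two
selected points at distance at most `N` on an orbit are impossible: from different stages, the later
one would have been rejected; from the same stage, the return property of `E k` forbids it. -/
theorem MeasurableEquiv.exists_sweep (T : X ≃ᵐ X) (N : ℕ) {E : ℕ → Set X}
    (hE : ∀ k, MeasurableSet (E k))
    (hEret : ∀ k, ∀ x ∈ E k, ∀ i, 1 ≤ i → i ≤ N → T^[i] x ∉ E k) :
    ∃ A : Set X, MeasurableSet A ∧ (∀ x ∈ A, ∀ i, 1 ≤ i → i ≤ N → T^[i] x ∉ A) ∧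
      ∀ k, E k ⊆ T.visits N A := by
  have hmono : Monotone (T.greedy N E) := monotone_nat_of_le_succ fun k => Set.subset_union_left
  have hjoin : ∀ x, x ∈ ⋃ k, T.greedy N E k →
      ∃ k, x ∈ E k ∧ x ∉ T.visits N (T.greedy N E k) ∧ x ∈ T.greedy N E (k + 1) := by
    intro x hx
    obtain ⟨k, hk⟩ := Set.mem_iUnion.1 hx
    clear hx
    induction k with
    | zero => exact hk.elim
    | succ k ih =>
      rcases hk with h | h
      · exact ih h
      · exact ⟨k, h.1, h.2, Or.inr h⟩
  refine ⟨⋃ k, T.greedy N E k, MeasurableSet.iUnion fun k => ?_, ?_, ?_⟩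
  · induction k with
    | zero => exact MeasurableSet.empty
    | succ k ih => exact ih.union ((hE k).diff (T.measurableSet_visits N ih))
  · intro x hx i hi hiN hTx
    obtain ⟨k, hk1, hk2, hk3⟩ := hjoin x hx
    obtain ⟨l, hl1, hl2, hl3⟩ := hjoin _ hTx
    rcases lt_trichotomy k l with h | h | h
    · refine hl2 ⟨i, hiN, Or.inr ?_⟩
      have := T.symm_iterate_add i 0 x
      simp only [add_zero, Function.iterate_zero, id] at this
      rw [this]
      exact hmono h hk3
    · subst h
      exact hEret k x hk1 i hi hiN hl1
    · exact hk2 ⟨i, hiN, Or.inl (hmono h hl3)⟩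
  · intro k x hx
    by_cases h : x ∈ T.visits N (T.greedy N E k)
    · obtain ⟨i, hi, h⟩ := h
      refine ⟨i, hi, h.imp (fun h => Set.mem_iUnion.2 ⟨k, h⟩) fun h => Set.mem_iUnion.2 ⟨k, h⟩⟩
    · exact ⟨0, Nat.zero_le _, Or.inl (Set.mem_iUnion.2 ⟨k + 1, Or.inr ⟨hx, h⟩⟩)⟩

theorem MeasureTheory.MeasurePreserving.mul_measure_le_one [IsProbabilityMeasure μ] {T : X ≃ᵐ X}
    (hT : MeasurePreserving T μ μ) {N : ℕ} {A : Set X} (hA : MeasurableSet A)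
    (h : ∀ x ∈ A, ∀ i, 1 ≤ i → i ≤ N → T^[i] x ∉ A) : (N + 1) * μ.real A ≤ 1 := by
  have h1 : ∀ i ∈ Finset.range (N + 1), μ.real (T^[i] ⁻¹' A) = μ.real A := fun i _ =>
    (hT.iterate i).measureReal_preimage hA.nullMeasurableSet
  have h2 : μ.real (⋃ i ∈ Finset.range (N + 1), T^[i] ⁻¹' A) = (N + 1) * μ.real A := by
    rw [measureReal_biUnion_finset, Finset.sum_congr rfl h1]
    · simp
    · have key : ∀ i j, i < j → j < N + 1 → Disjoint (T^[i] ⁻¹' A) (T^[j] ⁻¹' A) := by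
        intro i j hij hj
        refine Set.disjoint_left.2 fun x hx hx' => h _ hx (j - i) (by lia) (by lia) ?_
        rw [← Function.iterate_add_apply, Nat.sub_add_cancel hij.le]
        exact hx'
      intro i hi j hj hij
      rw [Finset.coe_range] at hi hj
      rcases lt_or_gt_of_ne hij with hlt | hlt
      · exact key i j hlt hj
      · exact (key j i hlt hi).symm
    · exact fun i _ => T.measurable.iterate i hA
  rw [← h2]
  exact measureReal_le_one

variable [StandardBorelSpace X]

/-- For a nonperiodic point the next `N` points of the orbit form a finite set avoiding it, so in an
embedding into `ℝ` a basic open set separates the point from them. -/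
theorem exists_late_return_sets (T : X ≃ᵐ X) (N : ℕ) : ∃ E : ℕ → Set X,
    (∀ k, MeasurableSet (E k)) ∧ (∀ k, ∀ x ∈ E k, ∀ i, 1 ≤ i → i ≤ N → T^[i] x ∉ E k) ∧
    ∀ x, (∀ i, 1 ≤ i → T^[i] x ≠ x) → ∃ k, x ∈ E k := by
  obtain ⟨b, hbc, -, hb⟩ := TopologicalSpace.exists_countable_basis ℝ
  have hbn : b.Nonempty :=
    let ⟨s, hs, _⟩ := hb.exists_subset_of_mem_open (Set.mem_univ (0 : ℝ)) isOpen_univ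
    ⟨s, hs⟩
  obtain ⟨D, hD⟩ := hbc.exists_eq_range hbn
  let V : ℕ → Set X := fun k => embeddingReal X ⁻¹' D k
  have hDo : ∀ k, IsOpen (D k) := fun k => hb.isOpen (hD ▸ Set.mem_range_self k)
  have hV : ∀ k, MeasurableSet (V k) := fun k => measurable_embeddingReal X (hDo k).measurableSet
  refine ⟨fun k => V k ∩ ⋂ i ∈ Set.Icc 1 N, (T^[i] ⁻¹' V k)ᶜ, fun k => ?_, ?_, ?_⟩
  · exact (hV k).inter (MeasurableSet.biInter (Set.to_countable _) fun i _ =>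
      (T.measurable.iterate i (hV k)).compl)
  · rintro k x ⟨-, hx⟩ i h1 h2 ⟨hx', -⟩
    exact Set.mem_iInter₂.1 hx i ⟨h1, h2⟩ hx'
  · intro x hx
    let F : Set ℝ := (fun i => embeddingReal X (T^[i] x)) '' Set.Icc 1 N
    have hF : F.Finite := (Set.finite_Icc 1 N).image _
    have hxF : embeddingReal X x ∉ F := by
      rintro ⟨i, hi, h⟩
      exact hx i hi.1 ((measurableEmbedding_embeddingReal X).injective h)
    obtain ⟨s, hs, hxs, hsF⟩ := hb.exists_subset_of_mem_open (show embeddingReal X x ∈ Fᶜ from hxF)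
      hF.isClosed.isOpen_compl
    obtain ⟨k, rfl⟩ := hD ▸ hs
    refine ⟨k, hxs, Set.mem_iInter₂.2 fun i hi h => ?_⟩
    exact hsF h ⟨i, hi, rfl⟩

theorem exists_small_sweep [IsProbabilityMeasure μ] {T : X ≃ᵐ X} (hT : MeasurePreserving T μ μ)
    (hap : ∀ᵐ x ∂μ, ∀ i, 1 ≤ i → T^[i] x ≠ x) (N : ℕ) :
    ∃ A : Set X, MeasurableSet A ∧ (N + 1) * μ.real A ≤ 1 ∧ ∀ᵐ x ∂μ, ∃ k, T^[k] x ∈ A := by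
  obtain ⟨E, hE, hEret, hEx⟩ := exists_late_return_sets T N
  obtain ⟨A, hA, hAret, hEA⟩ := T.exists_sweep N hE hEret
  refine ⟨A, hA, hT.mul_measure_le_one hA hAret, ?_⟩
  -- Sweeping is applied at `T^N x`, so that a visit at time as early as `-N` from there is a visit
  -- at nonnegative time from `x`.
  filter_upwards [(hT.iterate N).quasiMeasurePreserving.ae hap] with x hx
  obtain ⟨k, hk⟩ := hEx _ hx
  obtain ⟨i, hi, h | h⟩ := hEA k hk
  · exact ⟨i + N, by rwa [Function.iterate_add_apply]⟩
  · refine ⟨N - i, ?_⟩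
    rwa [← T.symm_iterate_add i (N - i) x, Nat.add_sub_cancel' hi]

/-- **Rokhlin's lemma**. -/
theorem exists_rokhlin_tower [IsProbabilityMeasure μ] {T : X ≃ᵐ X} (hT : MeasurePreserving T μ μ)
    (hap : ∀ᵐ x ∂μ, ∀ i, 1 ≤ i → T^[i] x ≠ x) {n : ℕ} (hn : 1 ≤ n) {δ : ℝ} (hδ : 0 < δ) :
    ∃ B : Set X, MeasurableSet B ∧ (∀ x ∈ B, ∀ i, 1 ≤ i → i < n → T^[i] x ∉ B) ∧
      1 - δ ≤ n * μ.real B := by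
  classical
  -- This makes `n * μ.real A ≤ δ`, which bounds the part of the space missed by the tower.
  obtain ⟨N, hN⟩ := exists_nat_gt (n / δ)
  obtain ⟨A, hA, hAN, hAx⟩ := exists_small_sweep hT hap N
  -- `W k` consists of the points whose first visit to `A` is at time `k`.
  let W : ℕ → Set X := fun k => T^[k] ⁻¹' A ∩ ⋂ i ∈ Set.Iio k, (T^[i] ⁻¹' A)ᶜ
  have hW : ∀ k, MeasurableSet (W k) := fun k => (T.measurable.iterate k hA).inter
    (MeasurableSet.biInter (Set.to_countable _) fun i _ => (T.measurable.iterate i hA).compl)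
  have hWmem : ∀ k x, x ∈ W k ↔ T^[k] x ∈ A ∧ ∀ i < k, T^[i] x ∉ A := by
    intro k x; simp [W]
  have hWuniq : ∀ k l x, x ∈ W k → x ∈ W l → k = l := by
    intro k l x hk hl
    rw [hWmem] at hk hl
    refine le_antisymm (not_lt.1 fun h => hk.2 l h hl.1) (not_lt.1 fun h => hl.2 k h hk.1)
  have hWT : ∀ k i x, x ∈ W (i + k) → T^[i] x ∈ W k := by
    intro k i x hx
    rw [hWmem] at hx ⊢
    refine ⟨?_, fun j hj => ?_⟩
    · rw [← Function.iterate_add_apply, add_comm]; exact hx.1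
    · rw [← Function.iterate_add_apply]; exact hx.2 _ (by lia)
  -- The hitting time of `A` drops by one at each step until `A` is reached, so along the tower over
  -- the residue `n - 1` the residues descend to `0`.
  let B : Set X := ⋃ q : ℕ, W (q * n + (n - 1))
  have hB : MeasurableSet B := MeasurableSet.iUnion fun q => hW _
  refine ⟨B, hB, ?_, ?_⟩
  · intro x hx i hi1 hin hTx
    obtain ⟨q, hq⟩ := Set.mem_iUnion.1 hx
    obtain ⟨q', hq'⟩ := Set.mem_iUnion.1 hTx
    have h1 := hWT (q * n + (n - 1) - i) i x (by
      rwa [Nat.add_sub_cancel' (by lia)])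
    have h2 := hWuniq _ _ _ h1 hq'
    have h3 : q * n + (n - 1) = q' * n + (n - 1) + i := by lia
    have h4 : i = (q - q') * n := by rw [Nat.sub_mul]; lia
    rcases Nat.eq_zero_or_pos (q - q') with h | h
    · rw [h] at h4; lia
    · have := Nat.le_mul_of_pos_left n h
      lia
  · have hcover : ∀ᵐ x ∂μ, x ∈ (⋃ i ∈ Finset.range n, T.symm^[i] ⁻¹' B) ∪
        ⋃ i ∈ Finset.range n, T.symm^[i] ⁻¹' A := by
      filter_upwards [hAx] with x hx
      by_cases hxA : ∃ i < n, T.symm^[i] x ∈ A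
      · obtain ⟨i, hi, h⟩ := hxA
        exact Or.inr (Set.mem_biUnion (Finset.mem_coe.2 (Finset.mem_range.2 hi)) h)
      · push Not at hxA
        left
        let r := Nat.find hx
        have hr : T^[r] x ∈ A := Nat.find_spec hx
        have hr' : ∀ i < r, T^[i] x ∉ A := fun i hi => Nat.find_min hx hi
        have hmod : r % n < n := Nat.mod_lt _ hn
        -- Going back `i` steps raises the hitting time to residue `n - 1`, provided that the
        -- backward orbit avoids `A`; the exceptions lie in the second union.
        let i := n - 1 - r % n
        have hi : i < n := by simp only [i]; lia
        refine Set.mem_biUnion (Finset.mem_coe.2 (Finset.mem_range.2 hi)) ?_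
        refine Set.mem_iUnion.2 ⟨r / n, ?_⟩
        have hk : r / n * n + (n - 1) = i + r := by
          have := Nat.div_add_mod' r n
          simp only [i]; lia
        rw [hk, hWmem]
        have hback : ∀ m, T^[i + m] (T.symm^[i] x) = T^[m] x := by
          intro m
          rw [add_comm, Function.iterate_add_apply]
          exact congrArg _ (T.iterate_symm_add i 0 x)
        refine ⟨by rw [hback]; exact hr, fun j hj => ?_⟩
        rcases lt_or_ge j i with h | h
        · have h3 := T.iterate_symm_add j (i - j) x
          rw [Nat.add_sub_cancel' h.le] at h3
          rw [h3]
          exact hxA _ (by lia)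
        · obtain ⟨m, rfl⟩ := Nat.exists_eq_add_of_le h
          rw [hback]
          exact hr' m (by lia)
    have hsymm : MeasurePreserving T.symm μ μ := hT.symm T
    have hsum : ∀ S : Set X, MeasurableSet S →
        μ.real (⋃ i ∈ Finset.range n, T.symm^[i] ⁻¹' S) ≤ n * μ.real S := by
      intro S hS
      refine (measureReal_biUnion_finset_le _ _).trans_eq ?_
      rw [Finset.sum_congr rfl fun i _ =>
        (hsymm.iterate i).measureReal_preimage hS.nullMeasurableSet]
      simp
    have h1 : (1 : ℝ) ≤ n * μ.real B + n * μ.real A := by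
      have h2 := measureReal_union_le (μ := μ) (⋃ i ∈ Finset.range n, T.symm^[i] ⁻¹' B)
        (⋃ i ∈ Finset.range n, T.symm^[i] ⁻¹' A)
      have h3 : μ.real ((⋃ i ∈ Finset.range n, T.symm^[i] ⁻¹' B) ∪
          ⋃ i ∈ Finset.range n, T.symm^[i] ⁻¹' A) = 1 := by
        exact (measureReal_congr (t := Set.univ) (eventuallyEq_univ.2 hcover)).trans (by simp)
      linarith [hsum A hA, hsum B hB]
    have h2 : n * μ.real A ≤ δ := by
      have h3 : (n : ℝ) ≤ δ * (N + 1) := by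
        have := (div_lt_iff₀ hδ).1 hN
        nlinarith
      calc n * μ.real A ≤ δ * (N + 1) * μ.real A := by gcongr
        _ = δ * ((N + 1) * μ.real A) := by ring
        _ ≤ δ * 1 := by gcongr
        _ = δ := mul_one δ
    linarith

/-- An isomorphism with `[0,1]` that places `B` first makes it an initial interval up to a null set,
which can be cut at `c`. -/
theorem exists_subset_measureReal_eq [IsProbabilityMeasure μ] [NullSingletonClass μ] {B : Set X}
    (hB : MeasurableSet B) {c : ℝ} (hc0 : 0 ≤ c) (hc : c ≤ μ.real B) :
    ∃ B' ⊆ B, MeasurableSet B' ∧ μ.real B' = c := by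
  classical
  let f : X → ℕ := fun x => if x ∈ B then 0 else 1
  have hf : Measurable f := Measurable.ite hB measurable_const measurable_const
  obtain ⟨e, he, hea⟩ := exists_measurableEquiv_unitInterval (μ := μ) hf
  let t : I := ⟨c, hc0, hc.trans measureReal_le_one⟩
  refine ⟨B ∩ e ⁻¹' Set.Iio t, Set.inter_subset_left, hB.inter (e.measurable measurableSet_Iio), ?_⟩
  have hBf : {x | f x < (1 : ℕ)} = B := by
    ext x; by_cases hx : x ∈ B <;> simp [f, hx]
  have h1 : (B ∩ e ⁻¹' Set.Iio t : Set X) =ᵐ[μ] e ⁻¹' Set.Iio t := by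
    filter_upwards [hea] with x hx
    refine propext ⟨fun h => h.2, fun h => ⟨?_, h⟩⟩
    by_contra hxB
    have h2 := (hx 1).2 (by simp [f, hxB])
    rw [hBf] at h2
    have h3 : (e x : ℝ) < c := h
    linarith
  rw [measureReal_congr h1, he.measureReal_preimage measurableSet_Iio.nullMeasurableSet,
    measureReal_def, unitInterval.volume_Iio, ENNReal.toReal_ofReal hc0]

/-- Rokhlin's lemma with a base of prescribed measure. -/
theorem exists_rokhlin_tower_eq [IsProbabilityMeasure μ] [NullSingletonClass μ] {T : X ≃ᵐ X}
    (hT : MeasurePreserving T μ μ) (hap : ∀ᵐ x ∂μ, ∀ i, 1 ≤ i → T^[i] x ≠ x) {n : ℕ} (hn : 1 ≤ n)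
    {c : ℝ} (hc : 0 ≤ c) (hnc : n * c < 1) :
    ∃ B : Set X, MeasurableSet B ∧ (∀ x ∈ B, ∀ i, 1 ≤ i → i < n → T^[i] x ∉ B) ∧ μ.real B = c := by
  obtain ⟨B, hB, hBn, hBμ⟩ := exists_rokhlin_tower hT hap hn (sub_pos.2 hnc)
  have hn' : (0 : ℝ) < n := by exact_mod_cast hn
  obtain ⟨B', hB', hB'm, h⟩ := exists_subset_measureReal_eq hB hc
    (le_of_mul_le_mul_left (by linarith) hn')
  exact ⟨B', hB'm, fun x hx i h1 h2 h3 => hBn x (hB' hx) i h1 h2 (hB' h3), h⟩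

end Rokhlin

/-! ### Approximate conjugacy of aperiodic automorphisms -/

section Conjugacy

variable {X Y : Type*} [MeasurableSpace X] [MeasurableSpace Y] {μ : Measure X} {ν : Measure Y}

open Classical in
/-- The level of a point in the tower of height `n` over `B`; points outside of the tower have
level `n`. -/
def MeasurableEquiv.level (T : X ≃ᵐ X) (B : Set X) (n : ℕ) (x : X) : ℕ :=
  if h : ∃ i < n, T.symm^[i] x ∈ B then Nat.find h else n

theorem MeasurableEquiv.level_eq_iff (T : X ≃ᵐ X) {B : Set X} {n : ℕ}
    (hB : ∀ x ∈ B, ∀ i, 1 ≤ i → i < n → T^[i] x ∉ B) {i : ℕ} (hi : i < n) (x : X) :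
    T.level B n x = i ↔ T.symm^[i] x ∈ B := by
  classical
  have huniq : ∀ j k, j < k → k < n → T.symm^[k] x ∈ B → T.symm^[j] x ∉ B := by
    intro j k hjk hk h1 h2
    refine hB _ h1 (k - j) (by lia) (by lia) ?_
    have := T.iterate_symm_add (k - j) j x
    rw [Nat.sub_add_cancel hjk.le] at this
    rwa [this]
  unfold level
  split_ifs with h
  · constructor
    · rintro rfl
      exact (Nat.find_spec h).2
    · intro hx
      refine (Nat.find_eq_iff h).2 ⟨⟨hi, hx⟩, fun m hm hm' => ?_⟩
      exact huniq m i hm hi hx hm'.2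
  · refine ⟨fun hn => absurd hn hi.ne', fun hx => absurd ⟨i, hi, hx⟩ h⟩

theorem MeasurableEquiv.level_le (T : X ≃ᵐ X) (B : Set X) (n : ℕ) (x : X) : T.level B n x ≤ n := by
  classical
  unfold level
  split_ifs with h
  · exact (Nat.find_spec h).1.le
  · exact le_rfl

theorem MeasurableEquiv.level_preimage_last (T : X ≃ᵐ X) (B : Set X) (n : ℕ) :
    T.level B n ⁻¹' {n} = (⋃ i ∈ Finset.range n, T.level B n ⁻¹' {i})ᶜ := by
  ext x
  have := T.level_le B n x
  simp
  lia

theorem MeasurableEquiv.level_preimage (T : X ≃ᵐ X) {B : Set X} {n : ℕ}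
    (hB : ∀ x ∈ B, ∀ i, 1 ≤ i → i < n → T^[i] x ∉ B) {i : ℕ} (hi : i < n) :
    T.level B n ⁻¹' {i} = T.symm^[i] ⁻¹' B := by
  ext x; exact T.level_eq_iff hB hi x

theorem MeasurableEquiv.level_preimage_of_lt (T : X ≃ᵐ X) {B : Set X} {n i : ℕ} (hi : n < i) :
    T.level B n ⁻¹' {i} = ∅ := by
  ext x
  have := T.level_le B n x
  simp
  lia

theorem MeasurableEquiv.measurableSet_level_preimage (T : X ≃ᵐ X) {B : Set X} {n : ℕ}
    (hB : ∀ x ∈ B, ∀ i, 1 ≤ i → i < n → T^[i] x ∉ B) (hBm : MeasurableSet B) (i : ℕ) :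
    MeasurableSet (T.level B n ⁻¹' {i}) := by
  have h1 : ∀ j < n, MeasurableSet (T.level B n ⁻¹' {j}) := fun j hj => by
    rw [T.level_preimage hB hj]; exact T.symm.measurable.iterate j hBm
  rcases lt_trichotomy i n with h | rfl | h
  · exact h1 i h
  · rw [T.level_preimage_last]
    exact (Finset.measurableSet_biUnion _ fun j hj => h1 j (Finset.mem_range.1 hj)).compl
  · rw [T.level_preimage_of_lt h]
    exact MeasurableSet.empty

theorem MeasurableEquiv.measurable_level (T : X ≃ᵐ X) {B : Set X} {n : ℕ}
    (hB : ∀ x ∈ B, ∀ i, 1 ≤ i → i < n → T^[i] x ∉ B) (hBm : MeasurableSet B) :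
    Measurable (T.level B n) :=
  measurable_to_countable' fun i => T.measurableSet_level_preimage hB hBm i

/-- The distribution of the level depends only on `n` and the measure of the base, so towers of two
systems can be matched by `exists_measurableEquiv_comp_ae_eq`. -/
theorem MeasurableEquiv.measureReal_level [IsProbabilityMeasure μ] {T : X ≃ᵐ X}
    (hT : MeasurePreserving T μ μ) {B : Set X} {n : ℕ}
    (hB : ∀ x ∈ B, ∀ i, 1 ≤ i → i < n → T^[i] x ∉ B) (hBm : MeasurableSet B) (i : ℕ) :
    μ.real (T.level B n ⁻¹' {i}) =
      if i < n then μ.real B else if i = n then 1 - n * μ.real B else 0 := by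
  have h1 : ∀ j < n, μ.real (T.level B n ⁻¹' {j}) = μ.real B := fun j hj => by
    rw [T.level_preimage hB hj]
    exact ((hT.symm T).iterate j).measureReal_preimage hBm.nullMeasurableSet
  have h2 := T.measurableSet_level_preimage hB hBm
  rcases lt_trichotomy i n with h | rfl | h
  · rw [if_pos h, h1 i h]
  · rw [if_neg (lt_irrefl _), if_pos rfl, T.level_preimage_last, probReal_compl_eq_one_sub
      (Finset.measurableSet_biUnion _ fun j _ => h2 j), measureReal_biUnion_finset
      (fun a _ b _ hab => Disjoint.preimage _ (Set.disjoint_singleton.2 hab)) (fun j _ => h2 j),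
      Finset.sum_congr rfl fun j hj => h1 j (Finset.mem_range.1 hj)]
    simp
  · rw [if_neg h.not_gt, if_neg h.ne', T.level_preimage_of_lt h]
    simp

/-- A map which is piecewise given by isomorphisms, in such a way that the pieces are disjointly
mapped, is measure preserving. -/
theorem measurePreserving_piecewise [IsProbabilityMeasure μ] [IsProbabilityMeasure ν]
    {f : X → ℕ} {g : Y → ℕ} (hf : Measurable f) (hg : Measurable g) {e : ℕ → X → Y}
    (he : ∀ i, MeasurePreserving (e i) μ ν) (hfg : ∀ᵐ x ∂μ, g (e (f x) x) = f x) :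
    MeasurePreserving (fun x => e (f x) x) μ ν := by
  have hm : Measurable fun x => e (f x) x := by
    have h1 : Measurable fun p : ℕ × X => e p.1 p.2 :=
      measurable_from_prod_countable_right fun i => (he i).measurable
    exact h1.comp (hf.prodMk measurable_id)
  have : IsProbabilityMeasure (μ.map fun x => e (f x) x) :=
    Measure.isProbabilityMeasure_map hm.aemeasurable
  -- Between probability measures a one-sided inequality forces equality.
  refine ⟨hm, Measure.eq_of_le_of_measure_univ_eq (Measure.le_iff.2 fun D hD => ?_) (by simp)⟩
  have hgi : ∀ i, MeasurableSet (g ⁻¹' {i}) := fun i => hg (measurableSet_singleton i)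
  rw [Measure.map_apply hm hD]
  calc μ ((fun x => e (f x) x) ⁻¹' D) ≤ μ (⋃ i, e i ⁻¹' (D ∩ g ⁻¹' {i})) := by
        refine measure_mono_ae ?_
        filter_upwards [hfg] with x hx hxD
        exact Set.mem_iUnion.2 ⟨f x, hxD, hx⟩
    _ ≤ ∑' i, μ (e i ⁻¹' (D ∩ g ⁻¹' {i})) := measure_iUnion_le _
    _ = ∑' i, ν (D ∩ g ⁻¹' {i}) := by
        congr 1
        ext i
        exact (he i).measure_preimage (hD.inter (hgi i)).nullMeasurableSet
    _ = ν (⋃ i, D ∩ g ⁻¹' {i}) := (measure_iUnion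
        (fun i j hij => ((Set.disjoint_singleton.2 hij).preimage g).mono
          Set.inter_subset_right Set.inter_subset_right) fun i => hD.inter (hgi i)).symm
    _ ≤ ν D := measure_mono (Set.iUnion_subset fun i => Set.inter_subset_left)

variable [StandardBorelSpace X] [StandardBorelSpace Y]

/-- Any two aperiodic automorphisms have conjugates which are uniformly close to each other. -/
theorem exists_conj_close [IsProbabilityMeasure μ] [NullSingletonClass μ] [IsProbabilityMeasure ν]
    [NullSingletonClass ν] {T : X ≃ᵐ X} {R : Y ≃ᵐ Y} (hT : MeasurePreserving T μ μ)
    (hR : MeasurePreserving R ν ν) (hTap : ∀ᵐ x ∂μ, ∀ i, 1 ≤ i → T^[i] x ≠ x)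
    (hRap : ∀ᵐ y ∂ν, ∀ i, 1 ≤ i → R^[i] y ≠ y) {ε : ℝ} (hε : 0 < ε) :
    ∃ e : X ≃ᵐ Y, MeasurePreserving e μ ν ∧ ν.real {y | e (T (e.symm y)) ≠ R y} ≤ ε := by
  -- With base measure `1 / (n + 1)`, the top level and the remainder each have measure `c`; the
  -- maps can differ only there, and `2 * c ≤ ε`.
  obtain ⟨n, hn⟩ := exists_nat_gt (2 / ε)
  have hn2 : 2 < n * ε := (div_lt_iff₀ hε).1 hn
  have hn0 : (0 : ℝ) < n := lt_trans (by positivity) hn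
  have hn1 : 1 ≤ n := by exact_mod_cast hn0
  set c : ℝ := 1 / (n + 1) with hc
  have hc0 : 0 ≤ c := by positivity
  have hc1 : (n + 1) * c = 1 := by rw [hc]; field_simp
  have hnc : n * c < 1 := by
    have : 0 < c := by positivity
    linarith
  obtain ⟨B, hBm, hB, hBc⟩ := exists_rokhlin_tower_eq hT hTap hn1 hc0 hnc
  obtain ⟨B', hBm', hB', hBc'⟩ := exists_rokhlin_tower_eq hR hRap hn1 hc0 hnc
  let f := T.level B n
  let g := R.level B' n
  have hf : Measurable f := T.measurable_level hB hBm
  have hg : Measurable g := R.measurable_level hB' hBm'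
  obtain ⟨e₀, he₀, hea₀⟩ := exists_measurableEquiv_comp_ae_eq (μ := μ) (ν := ν) hf hg fun a => by
    rw [← measureReal_eq_measureReal_iff]
    rw [MeasurableEquiv.measureReal_level hT hB hBm, MeasurableEquiv.measureReal_level hR hB' hBm',
      hBc, hBc']
  -- The conjugacy descends to the base with `T`, crosses by `e₀`, and climbs back with `R`. The
  -- value `0` off the tower leaves `e₀` unchanged there.
  let k : ℕ → ℕ := fun i => if i < n then i else 0
  let e₁ : ℕ → X → Y := fun i x => R^[k i] (e₀ (T.symm^[k i] x))
  have he₁ : ∀ i, MeasurePreserving (e₁ i) μ ν := fun i =>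
    (hR.iterate _).comp (he₀.comp ((hT.symm T).iterate _))
  have hei : ∀ i, Function.Injective (e₁ i) := fun i =>
    (R.injective.iterate _).comp (e₀.injective.comp (T.symm.injective.iterate _))
  have hlev : ∀ᵐ x ∂μ, g (e₁ (f x) x) = f x := by
    have h1 : ∀ᵐ x ∂μ, ∀ i, g (e₀ (T.symm^[i] x)) = f (T.symm^[i] x) :=
      ae_all_iff.2 fun i => ((hT.symm T).iterate i).quasiMeasurePreserving.ae hea₀
    filter_upwards [h1] with x hx
    rcases (T.level_le B n x).lt_or_eq with h | h
    · have hk : k (f x) = f x := if_pos h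
      have h2 : T.symm^[f x] x ∈ B := (T.level_eq_iff hB h x).1 rfl
      have h3 : f (T.symm^[f x] x) = 0 := (T.level_eq_iff hB hn1 _).2 h2
      have h4 : e₀ (T.symm^[f x] x) ∈ B' := by
        refine (R.level_eq_iff hB' hn1 _).1 ?_
        exact (hx (f x)).trans h3
      refine (R.level_eq_iff hB' h _).2 ?_
      simp only [e₁, hk]
      have h5 := R.symm_iterate_add (f x) 0 (e₀ (T.symm^[f x] x))
      rw [add_zero] at h5
      exact h5 ▸ h4
    · have hk : k (f x) = 0 := if_neg (by simp only [f]; lia)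
      simp only [e₁, hk]
      exact hx 0
  have hmp : MeasurePreserving (fun x => e₁ (f x) x) μ ν :=
    measurePreserving_piecewise hf hg he₁ hlev
  obtain ⟨e, he, hea⟩ := hmp.exists_measurableEquiv_ae_eq (C := {x | g (e₁ (f x) x) = f x}) hlev (by
    intro x hx y hy hxy
    have h1 : f x = f y := hx.symm.trans ((congrArg g hxy).trans hy)
    refine hei (f x) ?_
    simp only at hxy
    rw [hxy, h1])
  refine ⟨e, he, ?_⟩
  have hcomm : ∀ᵐ x ∂μ, f x + 1 < n → e (T x) = R (e x) := by
    filter_upwards [hea, hT.quasiMeasurePreserving.ae hea] with x h1 h2 h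
    have h3 : f (T x) = f x + 1 := by
      refine (T.level_eq_iff hB h _).2 ?_
      rw [Function.iterate_succ_apply, T.symm_apply_apply]
      exact (T.level_eq_iff hB (by lia) x).1 rfl
    rw [h1, h2, h3]
    have hk1 : k (f x + 1) = f x + 1 := if_pos h
    have hk2 : k (f x) = f x := if_pos (by lia)
    simp only [e₁, hk1, hk2]
    rw [Function.iterate_succ_apply', Function.iterate_succ_apply, T.symm_apply_apply]
  have hset : MeasurableSet (⋃ i ∈ Finset.range (n - 1), f ⁻¹' {i}) :=
    Finset.measurableSet_biUnion _ fun j _ => hf (measurableSet_singleton j)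
  have hμset : μ.real (⋃ i ∈ Finset.range (n - 1), f ⁻¹' {i}) = (n - 1) * c := by
    rw [measureReal_biUnion_finset
      (fun a _ b _ hab => Disjoint.preimage _ (Set.disjoint_singleton.2 hab))
      (fun j _ => hf (measurableSet_singleton j)), Finset.sum_congr rfl fun j hj => ?_]
    · rw [Finset.sum_const, Finset.card_range, nsmul_eq_mul, Nat.cast_sub hn1, Nat.cast_one]
    · rw [MeasurableEquiv.measureReal_level hT hB hBm, if_pos, hBc]
      have := Finset.mem_range.1 hj
      lia
  have hle : ν.real {y | e (T (e.symm y)) ≠ R y} ≤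
      μ.real (⋃ i ∈ Finset.range (n - 1), f ⁻¹' {i})ᶜ := by
    rw [measureReal_def, ← he.measure_preimage_equiv]
    refine ENNReal.toReal_mono (measure_ne_top _ _) (measure_mono_ae ?_)
    filter_upwards [hcomm] with x hx hxe hxs
    obtain ⟨i, hi, rfl⟩ := Set.mem_iUnion₂.1 hxs
    refine hxe ?_
    rw [e.symm_apply_apply]
    refine hx ?_
    have := Finset.mem_range.1 hi
    lia
  refine hle.trans ?_
  rw [probReal_compl_eq_one_sub hset, hμset]
  have h2 : 1 - (n - 1) * c = 2 * c := by linarith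
  rw [h2]
  have h3 : n * (2 * c) ≤ n * ε := by linarith
  exact le_of_mul_le_mul_left h3 hn0

end Conjugacy

/-! ### The weak topology as a group topology -/

namespace Aut01

theorem koopman_mk (S : MPMap) (f : Lp ℝ 2 (volume : Measure I)) :
    koopman (mk S) f = Lp.compMeasurePreserving S.toFun S.measurePreserving f := rfl

theorem interMeasure_mk (S : MPMap) (A B : Set I) :
    (mk S).interMeasure A B = volume.real (A ∩ S.toFun ⁻¹' B) := rfl

theorem mk_surjective : Function.Surjective mk := Con.mk'_surjective

theorem isometry_koopman (T : Aut01) : Isometry (koopman T) := by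
  obtain ⟨S, rfl⟩ := mk_surjective T
  exact Lp.isometry_compMeasurePreserving S.measurePreserving

theorem koopman_add (T : Aut01) (f g : Lp ℝ 2 (volume : Measure I)) :
    koopman T (f + g) = koopman T f + koopman T g := by
  obtain ⟨S, rfl⟩ := mk_surjective T
  exact map_add (Lp.compMeasurePreserving S.toFun S.measurePreserving) f g

theorem koopman_smul (T : Aut01) (c : ℝ) (f : Lp ℝ 2 (volume : Measure I)) :
    koopman T (c • f) = c • koopman T f := by
  obtain ⟨S, rfl⟩ := mk_surjective T
  exact (Lp.compMeasurePreservingₗ ℝ S.toFun S.measurePreserving).map_smul c f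

theorem norm_koopman (T : Aut01) (f : Lp ℝ 2 (volume : Measure I)) :
    ‖koopman T f‖ = ‖f‖ := by
  obtain ⟨S, rfl⟩ := mk_surjective T
  exact Lp.norm_compMeasurePreserving f S.measurePreserving

theorem koopman_mul (S T : Aut01) (f : Lp ℝ 2 (volume : Measure I)) :
    koopman (S * T) f = koopman T (koopman S f) := by
  obtain ⟨S, rfl⟩ := mk_surjective S
  obtain ⟨T, rfl⟩ := mk_surjective T
  rw [← map_mul, koopman_mk, koopman_mk, koopman_mk]
  refine Lp.ext ?_
  refine (Lp.coeFn_compMeasurePreserving f _).trans ?_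
  refine EventuallyEq.trans ?_ (Lp.coeFn_compMeasurePreserving _ _).symm
  have := T.measurePreserving.quasiMeasurePreserving.ae_eq_comp
    (Lp.coeFn_compMeasurePreserving f S.measurePreserving)
  exact this.symm

theorem koopman_one (f : Lp ℝ 2 (volume : Measure I)) : koopman 1 f = f := by
  rw [← map_one mk, koopman_mk]
  exact Lp.ext (Lp.coeFn_compMeasurePreserving f _)

theorem koopman_koopman_inv (T : Aut01) (f : Lp ℝ 2 (volume : Measure I)) :
    koopman T (koopman T⁻¹ f) = f := by
  rw [← koopman_mul, inv_mul_cancel, koopman_one]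

theorem continuous_koopman (f : Lp ℝ 2 (volume : Measure I)) :
    Continuous fun T : Aut01 => koopman T f :=
  (continuous_apply f).comp continuous_induced_dom

theorem tendsto_nhds_iff {ι : Type*} {l : Filter ι} {u : ι → Aut01} {T : Aut01} :
    Tendsto u l (𝓝 T) ↔ ∀ f, Tendsto (fun i => koopman (u i) f) l (𝓝 (koopman T f)) := by
  rw [nhds_induced, tendsto_comap_iff, tendsto_pi_nhds]
  rfl

instance : ContinuousMul Aut01 := ⟨by
  refine continuous_iff_continuousAt.2 fun p => tendsto_nhds_iff.2 fun f => ?_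
  simp only [koopman_mul]
  refine tendsto_iff_dist_tendsto_zero.2 ?_
  have h1 : Tendsto (fun q : Aut01 × Aut01 => dist (koopman q.1 f) (koopman p.1 f)
      + dist (koopman q.2 (koopman p.1 f)) (koopman p.2 (koopman p.1 f))) (𝓝 p) (𝓝 (0 + 0)) := by
    refine Tendsto.add (tendsto_iff_dist_tendsto_zero.1 ?_) (tendsto_iff_dist_tendsto_zero.1 ?_)
    · exact ((continuous_koopman f).comp continuous_fst).tendsto p
    · exact ((continuous_koopman _).comp continuous_snd).tendsto p
  rw [add_zero] at h1
  refine squeeze_zero (fun _ => dist_nonneg) (fun q => ?_) h1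
  refine (dist_triangle _ (koopman q.2 (koopman p.1 f)) _).trans ?_
  rw [(isometry_koopman q.2).dist_eq]⟩

/-- Applying the isometry of `S` turns the distance from `S⁻¹f` to `T⁻¹f` into the distance from `f`
to the image of `T⁻¹f` under `S`, which tends to `0` as `S → T`. -/
instance : ContinuousInv Aut01 := ⟨by
  refine continuous_iff_continuousAt.2 fun T => tendsto_nhds_iff.2 fun f => ?_
  have h := ((continuous_koopman (koopman T⁻¹ f)).tendsto T)
  rw [tendsto_iff_dist_tendsto_zero] at h ⊢
  refine h.congr fun S => ?_
  rw [koopman_koopman_inv, ← (isometry_koopman S).dist_eq (koopman S⁻¹ f), koopman_koopman_inv,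
    dist_comm]⟩

instance : IsTopologicalGroup Aut01 where

/-- The indicator function of a measurable set, as an element of `L²`. -/
def ind {B : Set I} (hB : MeasurableSet B) : Lp ℝ 2 (volume : Measure I) :=
  indicatorConstLp 2 hB (measure_ne_top _ _) 1

theorem koopman_mk_ind (S : MPMap) {B : Set I} (hB : MeasurableSet B) :
    koopman (mk S) (ind hB) = ind (S.measurePreserving.measurable hB) :=
  Lp.indicatorConstLp_compMeasurePreserving hB (measure_ne_top _ _) 1 S.measurePreserving

theorem inner_ind_koopman (T : Aut01) {A B : Set I} (hA : MeasurableSet A) (hB : MeasurableSet B) :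
    inner ℝ (ind hA) (koopman T (ind hB)) = T.interMeasure A B := by
  obtain ⟨S, rfl⟩ := mk_surjective T
  rw [koopman_mk_ind, interMeasure_mk, ind, ind, L2.inner_indicatorConstLp_one_indicatorConstLp_one]
  simp

theorem continuous_interMeasure {A B : Set I} (hA : MeasurableSet A) (hB : MeasurableSet B) :
    Continuous fun T : Aut01 => T.interMeasure A B := by
  simp only [← inner_ind_koopman _ hA hB]
  exact continuous_const.inner (continuous_koopman _)

/-- For vectors of equal norm, `‖u - v‖² = 2‖v‖² - 2⟨v, u⟩`. -/
theorem _root_.tendsto_of_tendsto_inner_self {E ι : Type*} [NormedAddCommGroup E]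
    [InnerProductSpace ℝ E] {l : Filter ι} {u : ι → E} {v : E} (hn : ∀ i, ‖u i‖ = ‖v‖)
    (h : Tendsto (fun i => inner ℝ v (u i)) l (𝓝 (inner ℝ v v))) : Tendsto u l (𝓝 v) := by
  rw [tendsto_iff_norm_sub_tendsto_zero]
  have h2 : Tendsto (fun i => ‖u i - v‖ ^ 2) l (𝓝 0) := by
    have h3 := (h.const_mul 2).const_sub (‖v‖ ^ 2 + ‖v‖ ^ 2)
    rw [real_inner_self_eq_norm_sq] at h3
    have h4 : ‖v‖ ^ 2 + ‖v‖ ^ 2 - 2 * ‖v‖ ^ 2 = 0 := by ring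
    rw [h4] at h3
    refine h3.congr fun i => ?_
    rw [norm_sub_sq_real, hn, real_inner_comm]
    ring
  simpa using h2.sqrt

theorem isClosed_setOf_tendsto_koopman {ι : Type*} (l : Filter ι) (u : ι → Aut01) (T : Aut01) :
    IsClosed {f | Tendsto (fun i => koopman (u i) f) l (𝓝 (koopman T f))} := by
  refine isClosed_iff_frequently.2 fun f hf => ?_
  refine Metric.tendsto_nhds.2 fun ε hε => ?_
  obtain ⟨g, hg, hgf⟩ :=
    (hf.and_eventually (Metric.ball_mem_nhds f (ε := ε / 3) (by positivity))).exists
  have hgf' : dist g f < ε / 3 := hgf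
  filter_upwards [Metric.tendsto_nhds.1 hg (ε / 3) (by positivity)] with i hi
  calc dist (koopman (u i) f) (koopman T f)
      ≤ dist (koopman (u i) f) (koopman (u i) g) + dist (koopman (u i) g) (koopman T g)
        + dist (koopman T g) (koopman T f) := dist_triangle4 _ _ _ _
    _ < ε / 3 + ε / 3 + ε / 3 := by
        rw [(isometry_koopman (u i)).dist_eq, (isometry_koopman T).dist_eq, dist_comm f g]
        gcongr
    _ = ε := by ring

theorem tendsto_nhds_of_interMeasure {ι : Type*} {l : Filter ι} {u : ι → Aut01} {T : Aut01}
    (h : ∀ A B, MeasurableSet A → MeasurableSet B →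
      Tendsto (fun i => (u i).interMeasure A B) l (𝓝 (T.interMeasure A B))) :
    Tendsto u l (𝓝 T) := by
  have hind : ∀ {B : Set I} (hB : MeasurableSet B),
      Tendsto (fun i => koopman (u i) (ind hB)) l (𝓝 (koopman T (ind hB))) := by
    intro B hB
    obtain ⟨S, rfl⟩ := mk_surjective T
    -- The test set is `S⁻¹B`, whose indicator is the expected limit; convergence of this inner
    -- product is already norm convergence.
    have h1 := h _ B (S.measurePreserving.measurable hB) hB
    simp only [← inner_ind_koopman _ (S.measurePreserving.measurable hB) hB] at h1
    rw [koopman_mk_ind] at h1 ⊢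
    refine tendsto_of_tendsto_inner_self (fun i => ?_) h1
    rw [norm_koopman, ← koopman_mk_ind, norm_koopman]
  refine tendsto_nhds_iff.2 fun f => ?_
  refine Lp.induction (p := 2) (by simp) (motive := fun f =>
    Tendsto (fun i => koopman (u i) f) l (𝓝 (koopman T f))) ?_ ?_ ?_ f
  · intro c s hs hμ
    have : (Lp.simpleFunc.indicatorConst 2 hs hμ.ne c : Lp ℝ 2 (volume : Measure I)) = c • ind hs := by
      rw [Lp.simpleFunc.coe_indicatorConst]
      refine Lp.ext (indicatorConstLp_coeFn.trans ?_)
      filter_upwards [Lp.coeFn_smul c (ind hs), indicatorConstLp_coeFn (p := 2) (hs := hs)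
        (hμs := measure_ne_top (volume : Measure I) s) (c := (1 : ℝ))] with x h1 h2
      rw [h1, Pi.smul_apply, ind, h2]
      by_cases hx : x ∈ s <;> simp [hx]
    rw [this]
    simp only [koopman_smul]
    exact (hind hs).const_smul c
  · intro f g hf hg _ h1 h2
    simp only [koopman_add]
    exact h1.add h2
  · exact isClosed_setOf_tendsto_koopman l u T

end Aut01

/-! ### The automorphism group is a Baire space -/

namespace MPMap

/-- The measure preserving map given by an isomorphism of measurable spaces. -/
def ofMeasurableEquiv (e : I ≃ᵐ I) (he : MeasurePreserving e volume volume) : MPMap :=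
  ⟨e.toEquiv, he, he.symm e⟩

/-- A measure preserving map as an isomorphism of measurable spaces. -/
def toMeasurableEquiv (S : MPMap) : I ≃ᵐ I where
  toEquiv := S.1
  measurable_toFun := S.2.1.measurable
  measurable_invFun := S.2.2.measurable

end MPMap

namespace MPMap

theorem measurable_toFun (S : MPMap) : Measurable S.toFun := S.measurePreserving.measurable

theorem inv_toFun_toFun (S : MPMap) (x : I) : S⁻¹.toFun (S.toFun x) = x :=
  Equiv.symm_apply_apply (S.1 : Equiv.Perm I) x

end MPMap

namespace Aut01

theorem mk_eq_mk_iff {S T : MPMap} : mk S = mk T ↔ S.toFun =ᵐ[volume] T.toFun :=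
  MPMap.aeCon.eq

/-- Continuous functions as elements of `L²`. -/
def cont (f : C(I, ℝ)) : Lp ℝ 2 (volume : Measure I) := ContinuousMap.toLp 2 volume ℝ f

theorem koopman_mk_cont (S : MPMap) (f : C(I, ℝ)) :
    koopman (mk S) (cont f) =ᵐ[volume] fun x => f (S.toFun x) :=
  (Lp.coeFn_compMeasurePreserving _ S.measurePreserving).trans
    (S.measurePreserving.quasiMeasurePreserving.ae_eq_comp (ContinuousMap.coeFn_toLp volume f))

/-- Dominated convergence handles continuous functions, which are dense; the Koopman operators are
isometries, so convergence passes to the closure. -/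
theorem tendsto_mk_of_ae_tendsto {S : ℕ → MPMap} {T : MPMap}
    (h : ∀ᵐ x : I, Tendsto (fun n => (S n).toFun x) atTop (𝓝 (T.toFun x))) :
    Tendsto (fun n => mk (S n)) atTop (𝓝 (mk T)) := by
  have hd : Dense (Set.range cont) :=
    ContinuousMap.toLp_denseRange (E := ℝ) (μ := (volume : Measure I)) (p := 2) ℝ (by simp)
  refine tendsto_nhds_iff.2 fun f => ?_
  refine (isClosed_setOf_tendsto_koopman atTop (fun n => mk (S n)) (mk T)).closure_subset_iff.2 ?_
    (hd f)
  rintro _ ⟨f, rfl⟩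
  refine tendsto_of_tendsto_inner_self (fun i => by rw [norm_koopman, norm_koopman]) ?_
  have hinner : ∀ S : MPMap, inner ℝ (koopman (mk T) (cont f)) (koopman (mk S) (cont f)) =
      ∫ x : I, f (S.toFun x) * f (T.toFun x) := by
    intro S
    rw [L2.inner_def]
    refine integral_congr_ae ?_
    filter_upwards [koopman_mk_cont S f, koopman_mk_cont T f] with x h1 h2
    rw [h1, h2]
    simp
  simp only [hinner]
  refine tendsto_integral_of_dominated_convergence (fun _ => ‖f‖ * ‖f‖) ?_ (integrable_const _) ?_ ?_
  · intro n
    exact ((f.continuous.measurable.comp (S n).measurable_toFun).mul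
      (f.continuous.measurable.comp T.measurable_toFun)).aestronglyMeasurable
  · intro n
    refine .of_forall fun x => ?_
    rw [norm_mul]
    gcongr <;> exact f.norm_coe_le_norm _
  · filter_upwards [h] with x hx
    exact ((f.continuous.tendsto _).comp hx).mul_const _

/-- The inclusion `[0,1] → ℝ` as an element of `L²`. -/
def incl : Lp ℝ 2 (volume : Measure I) := cont ⟨Subtype.val, continuous_subtype_val⟩

theorem koopman_mk_incl (S : MPMap) :
    koopman (mk S) incl =ᵐ[volume] fun x => (S.toFun x : ℝ) := koopman_mk_cont S _

theorem exists_subseq_ae_tendsto {S : ℕ → MPMap} {a : Lp ℝ 2 (volume : Measure I)}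
    (h : Tendsto (fun n => koopman (mk (S n)) incl) atTop (𝓝 a)) :
    ∃ ns : ℕ → ℕ, StrictMono ns ∧ ∀ᵐ x : I, ∃ y : I,
      Tendsto (fun n => (S (ns n)).toFun x) atTop (𝓝 y) ∧ (y : ℝ) = a x := by
  obtain ⟨ns, hns, hae⟩ := (tendstoInMeasure_of_tendsto_Lp h).exists_seq_tendsto_ae
  refine ⟨ns, hns, ?_⟩
  filter_upwards [hae, ae_all_iff.2 fun n => koopman_mk_incl (S n)] with x h1 h2
  simp only [h2] at h1
  have hmem : a x ∈ Set.Icc (0 : ℝ) 1 :=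
    isClosed_Icc.mem_of_tendsto h1 (.of_forall fun n => ((S (ns n)).toFun x).2)
  exact ⟨⟨a x, hmem⟩, tendsto_subtype_rng.2 h1, rfl⟩

/-- A realization of `Aut([0,1])` as a closed subset of a Hilbert space. -/
def toLpProd (T : Aut01) : Lp ℝ 2 (volume : Measure I) × Lp ℝ 2 (volume : Measure I) :=
  (koopman T incl, koopman T⁻¹ incl)

theorem continuous_toLpProd : Continuous toLpProd :=
  (continuous_koopman incl).prodMk ((continuous_koopman incl).comp continuous_inv)

theorem injective_toLpProd : Function.Injective toLpProd := by
  intro S T h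
  obtain ⟨S, rfl⟩ := mk_surjective S
  obtain ⟨T, rfl⟩ := mk_surjective T
  have h1 : koopman (mk S) incl = koopman (mk T) incl := congrArg Prod.fst h
  refine mk_eq_mk_iff.2 ?_
  filter_upwards [koopman_mk_incl S, koopman_mk_incl T] with x hS hT
  exact Subtype.ext (by rw [← hS, ← hT, h1])

/-- Convergence of the coordinate function in `L²` holds almost everywhere along a subsequence, and
this implies weak convergence. The first component suffices; the second is there for closedness of
the range. -/
theorem isInducing_toLpProd : IsInducing toLpProd := by
  refine isInducing_iff_nhds.2 fun T => le_antisymm continuous_toLpProd.continuousAt.le_comap ?_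
  refine tendsto_id'.1 (tendsto_of_subseq_tendsto fun u hu => ?_)
  have h1 : Tendsto (fun n => koopman (u n) incl) atTop (𝓝 (koopman T incl)) :=
    (continuous_fst.tendsto _).comp (tendsto_comap_iff.1 hu)
  obtain ⟨T, rfl⟩ := mk_surjective T
  choose S hS using fun n => mk_surjective (u n)
  simp only [← hS] at h1 ⊢
  obtain ⟨ns, -, hae⟩ := exists_subseq_ae_tendsto h1
  refine ⟨ns, tendsto_mk_of_ae_tendsto ?_⟩
  filter_upwards [hae, koopman_mk_incl T] with x hx hT
  obtain ⟨y, hy, hya⟩ := hx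
  have : y = T.toFun x := Subtype.ext (hya.trans hT)
  rwa [this] at hy

/-- If `S n` and its inverses converge almost everywhere, then the limit is invertible. -/
theorem exists_ae_tendsto_of_inv {S : ℕ → MPMap}
    (h : ∀ᵐ x : I, ∃ y, Tendsto (fun n => (S n).toFun x) atTop (𝓝 y))
    (h' : ∀ᵐ x : I, ∃ y, Tendsto (fun n => (S n)⁻¹.toFun x) atTop (𝓝 y)) :
    ∃ T : MPMap, ∀ᵐ x : I, Tendsto (fun n => (S n).toFun x) atTop (𝓝 (T.toFun x)) := by
  obtain ⟨g, hgm, hg⟩ := measurable_limit_of_tendsto_metrizable_ae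
    (fun n => (S n).measurable_toFun.aemeasurable) h
  obtain ⟨k, hkm, hk⟩ := measurable_limit_of_tendsto_metrizable_ae
    (fun n => (S n)⁻¹.measurable_toFun.aemeasurable) h'
  have hm1 : Measurable fun x : I => (g x, x) := hgm.prodMk measurable_id
  have hm2 : Measurable fun y : I => (y, k y) := measurable_id.prodMk hkm
  -- The laws of `(Sₙ x, x)` and `(y, Sₙ⁻¹ y)` coincide for each `n`, hence so do the limit laws.
  -- The first marginal shows that `g` preserves the measure, and concentration on the graph of `k`
  -- shows that `k ∘ g` is the identity almost everywhere.
  have hmap : (volume : Measure I).map (fun x => (g x, x)) =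
      (volume : Measure I).map fun y => (y, k y) := by
    have := Measure.isProbabilityMeasure_map (μ := (volume : Measure I)) hm1.aemeasurable
    have := Measure.isProbabilityMeasure_map (μ := (volume : Measure I)) hm2.aemeasurable
    refine ext_of_forall_integral_eq_of_IsFiniteMeasure fun F => ?_
    rw [integral_map hm1.aemeasurable F.continuous.measurable.aestronglyMeasurable,
      integral_map hm2.aemeasurable F.continuous.measurable.aestronglyMeasurable]
    have h1 : Tendsto (fun n => ∫ x : I, F ((S n).toFun x, x)) atTop
        (𝓝 (∫ x : I, F (g x, x))) := by
      refine tendsto_integral_of_dominated_convergence (fun _ => ‖F‖) (fun n => ?_)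
        (integrable_const _) (fun n => .of_forall fun x => F.norm_coe_le_norm _) ?_
      · exact (F.continuous.measurable.comp
          ((S n).measurable_toFun.prodMk measurable_id)).aestronglyMeasurable
      · filter_upwards [hg] with x hx
        exact (F.continuous.tendsto _).comp (hx.prodMk_nhds tendsto_const_nhds)
    have h2 : Tendsto (fun n => ∫ y : I, F (y, (S n)⁻¹.toFun y)) atTop
        (𝓝 (∫ y : I, F (y, k y))) := by
      refine tendsto_integral_of_dominated_convergence (fun _ => ‖F‖) (fun n => ?_)
        (integrable_const _) (fun n => .of_forall fun x => F.norm_coe_le_norm _) ?_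
      · exact (F.continuous.measurable.comp
          (measurable_id.prodMk (S n)⁻¹.measurable_toFun)).aestronglyMeasurable
      · filter_upwards [hk] with x hx
        exact (F.continuous.tendsto _).comp (tendsto_const_nhds.prodMk_nhds hx)
    refine tendsto_nhds_unique h1 (h2.congr fun n => ?_)
    have h3 := (S n).measurePreserving.integral_comp' (f := (S n).toMeasurableEquiv)
      (fun y : I => F (y, (S n)⁻¹.toFun y))
    rw [← h3]
    refine integral_congr_ae (.of_forall fun x => ?_)
    change F ((S n).toFun x, (S n)⁻¹.toFun ((S n).toFun x)) = _
    rw [MPMap.inv_toFun_toFun]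
  have hgmp : MeasurePreserving g volume volume := by
    refine ⟨hgm, ?_⟩
    have h1 := congrArg (Measure.map Prod.fst) hmap
    rw [Measure.map_map measurable_fst hm1, Measure.map_map measurable_fst hm2] at h1
    exact h1.trans Measure.map_id
  have hinv : ∀ᵐ x : I, k (g x) = x := by
    have hs : MeasurableSet {p : I × I | k p.1 = p.2} :=
      measurableSet_eq_fun (hkm.comp measurable_fst) measurable_snd
    have h1 : ∀ᵐ p ∂((volume : Measure I).map fun y => (y, k y)), k p.1 = p.2 :=
      (ae_map_iff hm2.aemeasurable hs).2 (.of_forall fun y => rfl)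
    rw [← hmap] at h1
    exact (ae_map_iff hm1.aemeasurable hs).1 h1
  obtain ⟨e, he, hea⟩ := hgmp.exists_measurableEquiv_ae_eq (C := {x | k (g x) = x}) hinv
    fun x hx y hy hxy => hx.symm.trans ((congrArg k hxy).trans hy)
  refine ⟨MPMap.ofMeasurableEquiv e he, ?_⟩
  filter_upwards [hg, hea] with x h1 h2
  change Tendsto _ _ (𝓝 (e x))
  rwa [h2]

theorem isClosed_range_toLpProd : IsClosed (Set.range toLpProd) := by
  refine isClosed_of_closure_subset fun p hp => ?_
  obtain ⟨v, hv, hvp⟩ := mem_closure_iff_seq_limit.1 hp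
  choose u hu using hv
  choose S hS using fun n => mk_surjective (u n)
  have hS' : ∀ n, mk (S n)⁻¹ = (u n)⁻¹ := fun n => by rw [map_inv, hS]
  have h1 : Tendsto (fun n => koopman (mk (S n)) incl) atTop (𝓝 p.1) := by
    refine ((continuous_fst.tendsto _).comp hvp).congr fun n => ?_
    simp [← hu, hS, toLpProd]
  have h2 : Tendsto (fun n => koopman (mk (S n)⁻¹) incl) atTop (𝓝 p.2) := by
    refine ((continuous_snd.tendsto _).comp hvp).congr fun n => ?_
    simp [← hu, hS', toLpProd]
  obtain ⟨ns, hns, hae⟩ := exists_subseq_ae_tendsto h1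
  obtain ⟨ms, hms, hae'⟩ := exists_subseq_ae_tendsto (S := fun n => (S (ns n))⁻¹)
    (h2.comp hns.tendsto_atTop)
  obtain ⟨T, hT⟩ := exists_ae_tendsto_of_inv (S := fun n => S (ns (ms n)))
    (hae.mono fun x ⟨y, hy, _⟩ => ⟨y, hy.comp hms.tendsto_atTop⟩)
    (hae'.mono fun x ⟨y, hy, _⟩ => ⟨y, hy⟩)
  refine ⟨mk T, ?_⟩
  have h3 := (continuous_toLpProd.tendsto _).comp (tendsto_mk_of_ae_tendsto hT)
  refine tendsto_nhds_unique h3 ?_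
  refine (hvp.comp (hns.comp hms).tendsto_atTop).congr fun n => ?_
  simp [← hu, hS]

instance : BaireSpace Aut01 := by
  have : TopologicalSpace.IsCompletelyPseudoMetrizableSpace Aut01 :=
    IsClosedEmbedding.IsCompletelyPseudoMetrizableSpace (f := toLpProd)
      ⟨⟨isInducing_toLpProd, injective_toLpProd⟩, isClosed_range_toLpProd⟩
  infer_instance

end Aut01

/-! ### The interpolation set as a countable intersection of open sets -/

namespace Aut01

/-- The limit of `μ(A ∩ T^{-m} B)` prescribed by the parameter `c`. -/
def mixLimit (c : ℝ) (A B : Set I) : ℝ :=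
  (1 - c) * volume.real (A ∩ B) + c * (volume.real A * volume.real B)

theorem abs_measureReal_inter_preimage_sub_le (S : MPMap) {A A' B B' : Set I}
    (hA : MeasurableSet A) (hA' : MeasurableSet A') (hB : MeasurableSet B)
    (hB' : MeasurableSet B') :
    |volume.real (A ∩ S.toFun ⁻¹' B) - volume.real (A' ∩ S.toFun ⁻¹' B')| ≤
      volume.real (symmDiff A A') + volume.real (symmDiff B B') := by
  refine (abs_measureReal_sub_le_measureReal_symmDiff'
    (hA.inter (S.measurable_toFun hB)).nullMeasurableSet
    (hA'.inter (S.measurable_toFun hB')).nullMeasurableSet (measure_ne_top _ _) (measure_ne_top _ _)).trans ?_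
  have h1 : volume.real (symmDiff B B') = volume.real (S.toFun ⁻¹' symmDiff B B') :=
    (S.measurePreserving.measureReal_preimage (hB.symmDiff hB').nullMeasurableSet).symm
  rw [h1]
  refine (measureReal_mono ?_).trans (measureReal_union_le _ _)
  intro x hx
  simp only [Set.mem_symmDiff, Set.mem_inter_iff, Set.mem_preimage, Set.mem_union] at hx ⊢
  tauto

theorem abs_interMeasure_sub_le (T : Aut01) {A A' B B' : Set I} (hA : MeasurableSet A)
    (hA' : MeasurableSet A') (hB : MeasurableSet B) (hB' : MeasurableSet B') :
    |T.interMeasure A B - T.interMeasure A' B'| ≤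
      volume.real (symmDiff A A') + volume.real (symmDiff B B') := by
  obtain ⟨S, rfl⟩ := mk_surjective T
  exact abs_measureReal_inter_preimage_sub_le S hA hA' hB hB'

theorem abs_mixLimit_sub_le {c : ℝ} (hc : c ∈ Set.Icc (0 : ℝ) 1) {A A' B B' : Set I}
    (hA : MeasurableSet A) (hA' : MeasurableSet A') (hB : MeasurableSet B)
    (hB' : MeasurableSet B') :
    |mixLimit c A B - mixLimit c A' B'| ≤
      volume.real (symmDiff A A') + volume.real (symmDiff B B') := by
  have h1 : |volume.real (A ∩ B) - volume.real (A' ∩ B')| ≤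
      volume.real (symmDiff A A') + volume.real (symmDiff B B') :=
    abs_measureReal_inter_preimage_sub_le 1 hA hA' hB hB'
  have hAA := abs_measureReal_sub_le_measureReal_symmDiff' hA.nullMeasurableSet
    hA'.nullMeasurableSet (measure_ne_top volume A) (measure_ne_top volume A')
  have hBB := abs_measureReal_sub_le_measureReal_symmDiff' hB.nullMeasurableSet
    hB'.nullMeasurableSet (measure_ne_top volume B) (measure_ne_top volume B')
  have h2 : |volume.real A * volume.real B - volume.real A' * volume.real B'| ≤
      volume.real (symmDiff A A') + volume.real (symmDiff B B') := by
    have h3 : volume.real A * volume.real B - volume.real A' * volume.real B' =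
        (volume.real A - volume.real A') * volume.real B +
          volume.real A' * (volume.real B - volume.real B') := by ring
    rw [h3]
    refine (abs_add_le _ _).trans (add_le_add ?_ ?_)
    · rw [abs_mul, abs_of_nonneg (measureReal_nonneg (s := B))]
      exact (mul_le_of_le_one_right (abs_nonneg _) measureReal_le_one).trans hAA
    · rw [abs_mul, abs_of_nonneg (measureReal_nonneg (s := A'))]
      exact (mul_le_of_le_one_left (abs_nonneg _) measureReal_le_one).trans hBB
  have h4 : mixLimit c A B - mixLimit c A' B' =
      (1 - c) * (volume.real (A ∩ B) - volume.real (A' ∩ B')) +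
        c * (volume.real A * volume.real B - volume.real A' * volume.real B') := by
    unfold mixLimit; ring
  have hc' : 0 ≤ 1 - c := sub_nonneg.2 hc.2
  rw [h4]
  refine (abs_add_le _ _).trans ?_
  rw [abs_mul, abs_mul, abs_of_nonneg hc.1, abs_of_nonneg hc']
  calc _ ≤ (1 - c) * (volume.real (symmDiff A A') + volume.real (symmDiff B B')) +
        c * (volume.real (symmDiff A A') + volume.real (symmDiff B B')) := by
        gcongr
        exact hc.1
    _ = _ := by ring

theorem exists_dense_seq_measurableSet : ∃ A : ℕ → Set I, (∀ a, MeasurableSet (A a)) ∧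
    ∀ B, MeasurableSet B → ∀ ε > 0, ∃ a, volume.real (symmDiff B (A a)) < ε := by
  obtain ⟨𝒜, h𝒜c, h𝒜⟩ := IsSeparable.exists_countable_measureDense (μ := (volume : Measure I))
  obtain ⟨A, rfl⟩ := h𝒜c.exists_eq_range h𝒜.nonempty
  refine ⟨A, fun a => h𝒜.measurable _ ⟨a, rfl⟩, fun B hB ε hε => ?_⟩
  obtain ⟨_, ⟨a, rfl⟩, ha⟩ := h𝒜.approx B hB (measure_ne_top _ _) ε hε
  refine ⟨a, ?_⟩
  rw [measureReal_def]
  exact (ENNReal.toReal_lt_of_lt_ofReal ha)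

/-- The Lipschitz bounds are uniform in `l`, so an `ε/3` argument extends convergence from the dense
sequence to all Borel sets. This serves both for mixing limits and for weak convergence. -/
theorem tendsto_of_tendsto_dense_seq {A : ℕ → Set I} (hA : ∀ a, MeasurableSet (A a))
    (hAd : ∀ B, MeasurableSet B → ∀ ε > 0, ∃ a, volume.real (symmDiff B (A a)) < ε)
    {F : ℕ → Set I → Set I → ℝ} {G : Set I → Set I → ℝ}
    (hF : ∀ l {A A' B B' : Set I}, MeasurableSet A → MeasurableSet A' → MeasurableSet B →
      MeasurableSet B' → |F l A B - F l A' B'| ≤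
        volume.real (symmDiff A A') + volume.real (symmDiff B B'))
    (hG : ∀ {A A' B B' : Set I}, MeasurableSet A → MeasurableSet A' → MeasurableSet B →
      MeasurableSet B' → |G A B - G A' B'| ≤
        volume.real (symmDiff A A') + volume.real (symmDiff B B'))
    (h : ∀ a b, Tendsto (fun l => F l (A a) (A b)) atTop (𝓝 (G (A a) (A b))))
    {B B' : Set I} (hB : MeasurableSet B) (hB' : MeasurableSet B') :
    Tendsto (fun l => F l B B') atTop (𝓝 (G B B')) := by
  refine Metric.tendsto_nhds.2 fun ε hε => ?_
  obtain ⟨a, ha⟩ := hAd B hB (ε / 6) (by positivity)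
  obtain ⟨b, hb⟩ := hAd B' hB' (ε / 6) (by positivity)
  filter_upwards [Metric.tendsto_nhds.1 (h a b) (ε / 3) (by positivity)] with l h1
  have h3 := hF l hB (hA a) hB' (hA b)
  have h4 := hG hB (hA a) hB' (hA b)
  rw [Real.dist_eq, abs_lt] at h1 ⊢
  rw [abs_le] at h3 h4
  constructor <;> linarith

theorem tendsto_of_forall_lt_abs_sub_lt {A : ℕ → Set I} {F : ℕ → Set I → Set I → ℝ}
    {G : Set I → Set I → ℝ}
    (h : ∀ l, ∀ a < l, ∀ b < l, |F l (A a) (A b) - G (A a) (A b)| < 1 / (l + 1)) (a b : ℕ) :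
    Tendsto (fun l => F l (A a) (A b)) atTop (𝓝 (G (A a) (A b))) := by
  refine tendsto_iff_dist_tendsto_zero.2 (squeeze_zero' (.of_forall fun _ => dist_nonneg) ?_
    (tendsto_one_div_add_atTop_nhds_zero_nat (𝕜 := ℝ)))
  filter_upwards [eventually_gt_atTop a, eventually_gt_atTop b] with l ha hb
  exact (h l a ha b hb).le

/-- The transformations with approximately the prescribed behaviour on the first `r` sets of a
sequence `A`, at some time of index at least `r`. -/
def approxSet {N : ℕ} (p : Fin N → ℕ → ℤ) (lam : Fin N → ℝ) (A : ℕ → Set I) (r : ℕ) : Set Aut01 :=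
  {T | ∃ k ≥ r, ∀ j, ∀ a < r, ∀ b < r,
    |(T ^ p j k).interMeasure (A a) (A b) - mixLimit (lam j) (A a) (A b)| < 1 / (r + 1)}

theorem isOpen_approxSet {N : ℕ} (p : Fin N → ℕ → ℤ) (lam : Fin N → ℝ) {A : ℕ → Set I}
    (hA : ∀ a, MeasurableSet (A a)) (r : ℕ) : IsOpen (approxSet p lam A r) := by
  have : approxSet p lam A r = ⋃ k ∈ Set.Ici r, ⋂ j, ⋂ a ∈ Set.Iio r, ⋂ b ∈ Set.Iio r,
      {T | |(T ^ p j k).interMeasure (A a) (A b) - mixLimit (lam j) (A a) (A b)| < 1 / (r + 1)} := by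
    ext T; simp [approxSet]
  rw [this]
  refine isOpen_biUnion fun k _ => isOpen_iInter_of_finite fun j =>
    (Set.finite_Iio r).isOpen_biInter fun a _ => (Set.finite_Iio r).isOpen_biInter fun b _ => ?_
  refine isOpen_lt (continuous_abs.comp (Continuous.sub ?_ continuous_const)) continuous_const
  exact (continuous_interMeasure (hA a) (hA b)).comp (continuous_zpow _)

/-- Membership at level `max r K` yields a time after `K` that is good for level `r`. Good times are
thus frequent for each `r`, and a strictly increasing choice, the `r`-th good for `r`, gives the
limits. -/
theorem interpolationSet_eq_iInter {N : ℕ} (φ : Fin N → ℕ → ℤ) (n : ℕ → ℕ) {lam : Fin N → ℝ}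
    (hlam : ∀ j, lam j ∈ Set.Icc (0 : ℝ) 1) {A : ℕ → Set I} (hA : ∀ a, MeasurableSet (A a))
    (hAd : ∀ B, MeasurableSet B → ∀ ε > 0, ∃ a, volume.real (symmDiff B (A a)) < ε) :
    interpolationSet φ n lam = ⋂ r, approxSet (fun j k => φ j (n k)) lam A r := by
  refine Set.Subset.antisymm (fun T hT => Set.mem_iInter.2 fun r => ?_) fun T hT => ?_
  · obtain ⟨k, hk, hlim⟩ := hT
    have h1 : ∀ᶠ l in atTop, ∀ j, ∀ a ∈ Set.Iio r, ∀ b ∈ Set.Iio r,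
        |(T ^ φ j (n (k l))).interMeasure (A a) (A b) - mixLimit (lam j) (A a) (A b)| <
          1 / (r + 1) := by
      refine eventually_all.2 fun j => (Set.finite_Iio r).eventually_all.2 fun a _ =>
        (Set.finite_Iio r).eventually_all.2 fun b _ => ?_
      have h2 := Metric.tendsto_nhds.1 (hlim j (A a) (A b) (hA a) (hA b)) (1 / (r + 1))
        (by positivity)
      exact h2
    obtain ⟨l, hl, hlr⟩ := (h1.and (eventually_ge_atTop r)).exists
    exact ⟨k l, hlr.trans (hk.le_apply), hl⟩
  · have hfreq : ∀ r, ∃ᶠ k in atTop, ∀ j, ∀ a < r, ∀ b < r,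
        |(T ^ φ j (n k)).interMeasure (A a) (A b) - mixLimit (lam j) (A a) (A b)| <
          1 / (r + 1) := by
      intro r
      refine frequently_atTop.2 fun K => ?_
      obtain ⟨k, hk, h⟩ := Set.mem_iInter.1 hT (max r K)
      refine ⟨k, (le_max_right _ _).trans hk, fun j a ha b hb => ?_⟩
      refine (h j a (lt_max_of_lt_left ha) b (lt_max_of_lt_left hb)).trans_le ?_
      have : (r : ℝ) ≤ (max r K : ℕ) := by exact_mod_cast le_max_left r K
      gcongr
    obtain ⟨k, hk, h⟩ := extraction_forall_of_frequently hfreq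
    refine ⟨k, hk, fun j B B' hB hB' => ?_⟩
    exact tendsto_of_tendsto_dense_seq hA hAd (G := mixLimit (lam j))
      (fun l => abs_interMeasure_sub_le (T ^ φ j (n (k l)))) (abs_mixLimit_sub_le (hlam j))
      (tendsto_of_forall_lt_abs_sub_lt fun l => h l j) hB hB'

end Aut01

/-! ### Realizations on the square and the cube -/

instance {X Y : Type*} [MeasureSpace X] [MeasureSpace Y] [SFinite (volume : Measure Y)]
    [NullSingletonClass (volume : Measure X)] :
    NullSingletonClass (volume : Measure (X × Y)) := by
  rw [Measure.volume_eq_prod]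
  infer_instance

namespace MPMap

theorem toFun_mul (S T : MPMap) (x : I) : (S * T).toFun x = S.toFun (T.toFun x) := rfl

theorem iterate_toMeasurableEquiv (S : MPMap) (i : ℕ) (x : I) :
    S.toMeasurableEquiv^[i] x = (S ^ i).toFun x := by
  induction i generalizing x with
  | zero => rfl
  | succ i ih => rw [Function.iterate_succ_apply, ih, pow_succ, toFun_mul]; rfl

theorem IsAperiodic.ae_iterate_ne {S : MPMap} (h : S.IsAperiodic) :
    ∀ᵐ x : I, ∀ i, 1 ≤ i → S.toMeasurableEquiv^[i] x ≠ x := by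
  filter_upwards [measure_eq_zero_iff_ae_notMem.1 h] with x hx i hi hix
  exact hx ⟨i, hi, by rw [← iterate_toMeasurableEquiv, hix]⟩

/-- An aperiodic transformation has a realization on the square which behaves on the first
coordinate like a prescribed transformation, up to a small error. -/
theorem exists_realization_on_square (S₀ : MPMap) {V : MPMap} (hV : V.IsAperiodic) {ε : ℝ}
    (hε : 0 < ε) : ∃ e : I ≃ᵐ I × I, MeasurePreserving e volume volume ∧
      ∀ A B : Set I, MeasurableSet A → MeasurableSet B →
        |volume.real (e ⁻¹' (A ×ˢ Set.univ) ∩ V.toFun ⁻¹' (e ⁻¹' (B ×ˢ Set.univ))) -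
          volume.real (A ∩ S₀.toFun ⁻¹' B)| ≤ ε := by
  -- `S₀` may have periodic points; the factor `V` makes the product aperiodic without affecting the
  -- first coordinate.
  let R : I × I ≃ᵐ I × I := S₀.toMeasurableEquiv.prodCongr V.toMeasurableEquiv
  have hR : MeasurePreserving R volume volume :=
    S₀.measurePreserving.prod V.measurePreserving
  have hRap : ∀ᵐ p : I × I, ∀ i, 1 ≤ i → R^[i] p ≠ p := by
    have h1 : ∀ᵐ p : I × I, ∀ i, 1 ≤ i → V.toMeasurableEquiv^[i] p.2 ≠ p.2 :=
      (Measure.quasiMeasurePreserving_snd (μ := (volume : Measure I))).ae hV.ae_iterate_ne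
    filter_upwards [h1] with p hp i hi hpi
    refine hp i hi ?_
    have hs : Function.Semiconj Prod.snd R V.toMeasurableEquiv := fun q => rfl
    rw [← (hs.iterate_right i).eq p, hpi]
  obtain ⟨e, he, hea⟩ := exists_conj_close (T := V.toMeasurableEquiv) V.measurePreserving hR
    hV.ae_iterate_ne hRap hε
  refine ⟨e, he, fun A B hA hB => ?_⟩
  have hVe : Measurable fun z : I × I => e (V.toFun (e.symm z)) :=
    e.measurable.comp (V.measurable_toFun.comp e.symm.measurable)
  have hA' : MeasurableSet (A ×ˢ (Set.univ : Set I)) := hA.prod .univ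
  have hB' : MeasurableSet (B ×ˢ (Set.univ : Set I)) := hB.prod .univ
  have h1 : volume.real (e ⁻¹' (A ×ˢ Set.univ) ∩ V.toFun ⁻¹' (e ⁻¹' (B ×ˢ Set.univ))) =
      volume.real (A ×ˢ Set.univ ∩ (fun z : I × I => e (V.toFun (e.symm z))) ⁻¹' (B ×ˢ Set.univ)) := by
    rw [← he.measureReal_preimage (hA'.inter (hVe hB')).nullMeasurableSet]
    congr 1
    ext x
    simp
  have h2 : volume.real (A ∩ S₀.toFun ⁻¹' B) =
      volume.real (A ×ˢ Set.univ ∩ R ⁻¹' (B ×ˢ Set.univ)) := by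
    have : A ×ˢ Set.univ ∩ R ⁻¹' (B ×ˢ Set.univ) =
        (A ∩ S₀.toFun ⁻¹' B) ×ˢ (Set.univ : Set I) := by
      ext p
      simp only [Set.mem_inter_iff, Set.mem_prod, Set.mem_univ, and_true, Set.mem_preimage]
      rfl
    rw [this, Measure.volume_eq_prod, measureReal_prod_prod]
    simp
  rw [h1, h2]
  refine (abs_measureReal_sub_le_measureReal_symmDiff' (hA'.inter (hVe hB')).nullMeasurableSet
    (hA'.inter (R.measurable hB')).nullMeasurableSet (measure_ne_top _ _)
    (measure_ne_top _ _)).trans ((measureReal_mono ?_).trans hea)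
  intro z hz hzR
  have hzR' : e (V.toFun (e.symm z)) = R z := hzR
  simp only [Set.mem_symmDiff, Set.mem_inter_iff, Set.mem_preimage, hzR'] at hz
  tauto

end MPMap

/-- An isomorphism of the cube with the unit interval which respects finitely many events of the
second coordinate. -/
theorem exists_cube_measurableEquiv {A : ℕ → Set I} (hA : ∀ a, MeasurableSet (A a)) (q : ℕ) :
    ∃ Ψ : I × (I × I) ≃ᵐ I, MeasurePreserving Ψ volume volume ∧
      ∀ᵐ ω : I × (I × I), ∀ a < q, Ψ ω ∈ A a ↔ ω.2.1 ∈ A a := by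
  classical
  -- `c` encodes which of the first `q` sets contain `x`; preserving it preserves each of these
  -- sets.
  let c : I → ℕ := fun x => Encodable.encode fun a : Fin q => decide (x ∈ A a)
  have hc : Measurable c := by
    refine (Measurable.of_discrete (f := Encodable.encode (α := Fin q → Bool))).comp ?_
    refine measurable_pi_lambda _ fun a => ?_
    refine measurable_to_bool ?_
    convert hA a using 1
    ext x
    simp
  have hp : MeasurePreserving (fun ω : I × (I × I) => ω.2.1) volume volume :=
    measurePreserving_fst.comp measurePreserving_snd
  obtain ⟨Ψ, hΨ, hae⟩ := exists_measurableEquiv_comp_ae_eq (μ := (volume : Measure (I × (I × I))))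
    (ν := (volume : Measure I)) (hc.comp hp.measurable) hc fun a => by
      rw [Set.preimage_comp]
      exact hp.measure_preimage (hc (measurableSet_singleton a)).nullMeasurableSet
  refine ⟨Ψ, hΨ, ?_⟩
  filter_upwards [hae] with ω hω a ha
  have h1 := congrFun (Encodable.encode_injective hω) ⟨a, ha⟩
  simpa using h1

/-! ### Fibrewise combination of finitely many transformations -/

section Weave

variable {Ξ : Type*}

/-- The fibrewise action on the cube of a family of transformations, where each `W ξ` is transported
to the square by `e ξ` and acts on the fibres over `s = ξ`. -/
def weaveMap (s : I → Ξ) (e : Ξ → I ≃ᵐ I × I) (W : Ξ → MPMap) (ω : I × (I × I)) : I × (I × I) :=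
  (ω.1, e (s ω.1) ((W (s ω.1)).toFun ((e (s ω.1)).symm ω.2)))

theorem weaveMap_mul (s : I → Ξ) (e : Ξ → I ≃ᵐ I × I) (W W' : Ξ → MPMap) (ω : I × (I × I)) :
    weaveMap s e (W * W') ω = weaveMap s e W (weaveMap s e W' ω) := by
  simp [weaveMap, MPMap.toFun_mul]

theorem weaveMap_one (s : I → Ξ) (e : Ξ → I ≃ᵐ I × I) (ω : I × (I × I)) :
    weaveMap s e 1 ω = ω := by
  have h : ∀ x, (1 : MPMap).toFun x = x := fun x => rfl
  simp [weaveMap, h]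

variable [Fintype Ξ] [MeasurableSpace Ξ] [MeasurableSingletonClass Ξ]

theorem measurePreserving_weaveMap {s : I → Ξ} (hs : Measurable s) {e : Ξ → I ≃ᵐ I × I}
    (he : ∀ ξ, MeasurePreserving (e ξ) volume volume) (W : Ξ → MPMap) :
    MeasurePreserving (weaveMap s e W) volume volume := by
  have hmp : ∀ ξ, MeasurePreserving (fun z : I × I => e ξ ((W ξ).toFun ((e ξ).symm z)))
      volume volume := fun ξ =>
    (he ξ).comp ((W ξ).measurePreserving.comp ((he ξ).symm (e ξ)))
  have hm : Measurable fun p : Ξ × (I × I) => e p.1 ((W p.1).toFun ((e p.1).symm p.2)) :=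
    measurable_from_prod_countable_right fun ξ => (hmp ξ).measurable
  refine MeasurePreserving.skew_product (MeasurePreserving.id (volume : Measure I))
    (g := fun θ z => e (s θ) ((W (s θ)).toFun ((e (s θ)).symm z))) ?_
    (.of_forall fun θ => (hmp (s θ)).map_eq)
  exact hm.comp ((hs.comp measurable_fst).prodMk measurable_snd)

/-- The transport of `weaveMap` to the unit interval. -/
def weave {s : I → Ξ} (hs : Measurable s) {e : Ξ → I ≃ᵐ I × I}
    (he : ∀ ξ, MeasurePreserving (e ξ) volume volume) {Ψ : I × (I × I) ≃ᵐ I}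
    (hΨ : MeasurePreserving Ψ volume volume) : (Ξ → MPMap) →* MPMap where
  toFun W := ⟨
    { toFun := fun x => Ψ (weaveMap s e W (Ψ.symm x))
      invFun := fun x => Ψ (weaveMap s e W⁻¹ (Ψ.symm x))
      left_inv := fun x => by
        simp only
        rw [Ψ.symm_apply_apply, ← weaveMap_mul, inv_mul_cancel, weaveMap_one, Ψ.apply_symm_apply]
      right_inv := fun x => by
        simp only
        rw [Ψ.symm_apply_apply, ← weaveMap_mul, mul_inv_cancel, weaveMap_one,
          Ψ.apply_symm_apply] },
    hΨ.comp ((measurePreserving_weaveMap hs he W).comp (hΨ.symm Ψ)),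
    hΨ.comp ((measurePreserving_weaveMap hs he W⁻¹).comp (hΨ.symm Ψ))⟩
  map_one' := Subtype.ext (Equiv.ext fun x => by
    change Ψ (weaveMap s e 1 (Ψ.symm x)) = x
    rw [weaveMap_one, Ψ.apply_symm_apply])
  map_mul' W W' := Subtype.ext (Equiv.ext fun x => by
    change Ψ (weaveMap s e (W * W') (Ψ.symm x)) =
      Ψ (weaveMap s e W (Ψ.symm (Ψ (weaveMap s e W' (Ψ.symm x)))))
    rw [weaveMap_mul, Ψ.symm_apply_apply])

/-- Up to null sets, `A` and `B` see only the first fibre coordinate, so the cube splits over the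
values of `s`. Since `weave` is a homomorphism, the formula also computes all powers. -/
theorem measureReal_inter_weave {s : I → Ξ} (hs : Measurable s) {e : Ξ → I ≃ᵐ I × I}
    (he : ∀ ξ, MeasurePreserving (e ξ) volume volume) {Ψ : I × (I × I) ≃ᵐ I}
    (hΨ : MeasurePreserving Ψ volume volume) {A B : Set I} (hA : MeasurableSet A)
    (hB : MeasurableSet B) (hΨA : ∀ᵐ ω : I × (I × I), Ψ ω ∈ A ↔ ω.2.1 ∈ A)
    (hΨB : ∀ᵐ ω : I × (I × I), Ψ ω ∈ B ↔ ω.2.1 ∈ B) (W : Ξ → MPMap) :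
    volume.real (A ∩ (weave hs he hΨ W).toFun ⁻¹' B) =
      ∑ ξ, volume.real (s ⁻¹' {ξ}) * volume.real (e ξ ⁻¹' (A ×ˢ Set.univ) ∩
        (W ξ).toFun ⁻¹' (e ξ ⁻¹' (B ×ˢ Set.univ))) := by
  have hwm := measurePreserving_weaveMap hs he W
  let C : Ξ → Set (I × I) := fun ξ => A ×ˢ Set.univ ∩
    (fun z => e ξ ((W ξ).toFun ((e ξ).symm z))) ⁻¹' (B ×ˢ Set.univ)
  have hC : ∀ ξ, MeasurableSet (C ξ) := fun ξ => (hA.prod .univ).inter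
    (((e ξ).measurable.comp ((W ξ).measurable_toFun.comp (e ξ).symm.measurable)) (hB.prod .univ))
  have h1 : volume.real (A ∩ (weave hs he hΨ W).toFun ⁻¹' B) =
      volume.real (⋃ ξ ∈ (Finset.univ : Finset Ξ), (s ⁻¹' {ξ}) ×ˢ C ξ) := by
    rw [← hΨ.measureReal_preimage
      (hA.inter ((weave hs he hΨ W).measurable_toFun hB)).nullMeasurableSet]
    refine measureReal_congr ?_
    filter_upwards [hΨA, hwm.quasiMeasurePreserving.ae hΨB] with ω h1 h2
    have h3 : (weave hs he hΨ W).toFun (Ψ ω) = Ψ (weaveMap s e W ω) := by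
      change Ψ (weaveMap s e W (Ψ.symm (Ψ ω))) = _
      rw [Ψ.symm_apply_apply]
    refine propext ?_
    change (Ψ ω ∈ A ∧ (weave hs he hΨ W).toFun (Ψ ω) ∈ B) ↔
      ω ∈ ⋃ ξ ∈ (Finset.univ : Finset Ξ), (s ⁻¹' {ξ}) ×ˢ C ξ
    rw [h3, h1, h2]
    simp [C, weaveMap]
  rw [h1, measureReal_biUnion_finset ?_ fun ξ _ => (hs (measurableSet_singleton ξ)).prod (hC ξ)]
  · refine Finset.sum_congr rfl fun ξ _ => ?_
    rw [Measure.volume_eq_prod, measureReal_prod_prod,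
      ← (he ξ).measureReal_preimage (hC ξ).nullMeasurableSet]
    congr 2
    ext x
    simp [C]
  · intro ξ _ ξ' _ hne
    exact Set.disjoint_prod.2 (Or.inl ((Set.disjoint_singleton.2 hne).preimage s))

end Weave

/-! ### Density of the approximating sets -/

namespace Aut01

theorem sum_measureReal_fiber_mul {Ξ : Type*} [Fintype Ξ] [MeasurableSpace Ξ]
    [MeasurableSingletonClass Ξ] {s : I → Ξ} (hs : Measurable s) (P : Ξ → Prop)
    [DecidablePred P] :
    ∑ ξ, volume.real (s ⁻¹' {ξ}) * (if P ξ then (1 : ℝ) else 0) = volume.real {θ | P (s θ)} := by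
  have h1 : {θ | P (s θ)} = ⋃ ξ ∈ Finset.univ.filter P, s ⁻¹' {ξ} := by
    ext θ; simp
  rw [h1, measureReal_biUnion_finset
    (fun a _ b _ hab => (Set.disjoint_singleton.2 hab).preimage s)
    fun ξ _ => hs (measurableSet_singleton ξ), Finset.sum_filter]
  exact Finset.sum_congr rfl fun ξ _ => by split_ifs <;> simp

theorem measureReal_coe_lt {c : ℝ} (hc : c ∈ Set.Icc (0 : ℝ) 1) :
    volume.real {θ : I | (θ : ℝ) < c} = c := by
  have : {θ : I | (θ : ℝ) < c} = Set.Iio ⟨c, hc⟩ := rfl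
  rw [this, measureReal_def, unitInterval.volume_Iio, ENNReal.toReal_ofReal hc.1]

theorem mixLimit_preimage_prod_univ {e : I ≃ᵐ I × I} (he : MeasurePreserving e volume volume)
    (c : ℝ) {A B : Set I} (hA : MeasurableSet A) (hB : MeasurableSet B) :
    mixLimit c (e ⁻¹' (A ×ˢ Set.univ)) (e ⁻¹' (B ×ˢ Set.univ)) = mixLimit c A B := by
  have h : ∀ D : Set I, MeasurableSet D →
      volume.real (e ⁻¹' (D ×ˢ Set.univ)) = volume.real D := by
    intro D hD
    rw [he.measureReal_preimage (hD.prod .univ).nullMeasurableSet, Measure.volume_eq_prod,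
      measureReal_prod_prod]
    simp
  have h2 : e ⁻¹' (A ×ˢ Set.univ) ∩ e ⁻¹' (B ×ˢ Set.univ) = e ⁻¹' ((A ∩ B) ×ˢ Set.univ) := by
    rw [← Set.preimage_inter, Set.prod_inter_prod, Set.univ_inter]
  rw [mixLimit, mixLimit, h2, h A hA, h B hB, h _ (hA.inter hB)]

/-- Near every transformation there is one with the prescribed limits on finitely many sets. -/
theorem exists_close_tendsto_mixLimit {N : ℕ} {φ : Fin N → ℕ → ℤ} {lam : Fin N → ℝ}
    (hlam : ∀ j, lam j ∈ Set.Icc (0 : ℝ) 1) {n : ℕ → ℕ} (hC : ConditionC φ n) {A : ℕ → Set I}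
    (hA : ∀ a, MeasurableSet (A a)) (q : ℕ) {ε : ℝ} (hε : 0 < ε) (T₀ : Aut01) :
    ∃ T : Aut01, (∀ a < q, ∀ b < q,
        |T.interMeasure (A a) (A b) - T₀.interMeasure (A a) (A b)| ≤ ε) ∧
      ∀ j, ∀ a < q, ∀ b < q, Tendsto (fun k => (T ^ φ j (n k)).interMeasure (A a) (A b)) atTop
        (𝓝 (mixLimit (lam j) (A a) (A b))) := by
  obtain ⟨S₀, rfl⟩ := mk_surjective T₀
  choose U hUap hUlim using fun ξ : Fin N → Bool =>
    hC.2 (fun j => if ξ j then 1 else 0) fun j => by split_ifs <;> simp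
  choose V hV using fun ξ => mk_surjective (U ξ)
  have hVap : ∀ ξ, (V ξ).IsAperiodic := fun ξ => by
    have := hUap ξ
    rwa [← hV] at this
  choose e he hea using fun ξ => S₀.exists_realization_on_square (hVap ξ) hε
  obtain ⟨Ψ, hΨ, hΨA⟩ := exists_cube_measurableEquiv hA q
  -- Only the marginals matter: `ξ j` must be true on a set of measure `lam j`. One common threshold
  -- variable does this for all `j` at once.
  let s : I → Fin N → Bool := fun θ j => decide ((θ : ℝ) < lam j)
  have hs : Measurable s := by
    refine measurable_pi_lambda _ fun j => measurable_to_bool ?_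
    have : (fun θ : I => s θ j) ⁻¹' {true} = {θ : I | (θ : ℝ) < lam j} := by
      ext θ; simp [s]
    rw [this]
    exact measurableSet_lt measurable_subtype_coe measurable_const
  have hsum : ∑ ξ, volume.real (s ⁻¹' {ξ}) = 1 := by
    have := sum_measureReal_fiber_mul hs fun _ => True
    simpa using this
  have hsumlam : ∀ j, ∑ ξ, volume.real (s ⁻¹' {ξ}) * (if ξ j then (1 : ℝ) else 0) = lam j := by
    intro j
    rw [sum_measureReal_fiber_mul hs fun ξ => ξ j = true]
    simp only [s, decide_eq_true_eq]
    exact measureReal_coe_lt (hlam j)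
  have hΨ' : ∀ a < q, ∀ᵐ ω : I × (I × I), Ψ ω ∈ A a ↔ ω.2.1 ∈ A a := fun a ha =>
    hΨA.mono fun ω h => h a ha
  refine ⟨mk (weave hs he hΨ V), fun a ha b hb => ?_, fun j a ha b hb => ?_⟩
  · rw [interMeasure_mk, interMeasure_mk,
      measureReal_inter_weave hs he hΨ (hA a) (hA b) (hΨ' a ha) (hΨ' b hb)]
    rw [← one_mul (volume.real (A a ∩ S₀.toFun ⁻¹' A b)), ← hsum, Finset.sum_mul,
      ← Finset.sum_sub_distrib]
    calc _ ≤ ∑ ξ, volume.real (s ⁻¹' {ξ}) * ε := by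
          refine (Finset.abs_sum_le_sum_abs _ _).trans (Finset.sum_le_sum fun ξ _ => ?_)
          rw [← mul_sub, abs_mul, abs_of_nonneg measureReal_nonneg]
          exact mul_le_mul_of_nonneg_left (hea ξ _ _ (hA a) (hA b)) measureReal_nonneg
      _ = ε := by rw [← Finset.sum_mul, hsum, one_mul]
  · have h1 : ∀ m : ℤ, ((mk (weave hs he hΨ V)) ^ m).interMeasure (A a) (A b) =
        ∑ ξ, volume.real (s ⁻¹' {ξ}) * ((U ξ) ^ m).interMeasure (e ξ ⁻¹' (A a ×ˢ Set.univ))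
          (e ξ ⁻¹' (A b ×ˢ Set.univ)) := by
      intro m
      rw [← map_zpow, ← map_zpow, interMeasure_mk,
        measureReal_inter_weave hs he hΨ (hA a) (hA b) (hΨ' a ha) (hΨ' b hb)]
      refine Finset.sum_congr rfl fun ξ _ => ?_
      rw [← hV, ← map_zpow, interMeasure_mk]
      rfl
    have h2 : mixLimit (lam j) (A a) (A b) = ∑ ξ, volume.real (s ⁻¹' {ξ}) *
        mixLimit (if ξ j then 1 else 0) (e ξ ⁻¹' (A a ×ˢ Set.univ))
          (e ξ ⁻¹' (A b ×ˢ Set.univ)) := by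
      simp only [mixLimit_preimage_prod_univ (he _) _ (hA a) (hA b)]
      -- The limit is affine in `c`, so averaging over `ξ` replaces `c` by its mean `lam j`.
      have h3 : ∀ c, mixLimit c (A a) (A b) = volume.real (A a ∩ A b) +
          c * (volume.real (A a) * volume.real (A b) - volume.real (A a ∩ A b)) := by
        intro c; unfold mixLimit; ring
      simp only [h3, mul_add, Finset.sum_add_distrib, ← mul_assoc]
      rw [← Finset.sum_mul, ← Finset.sum_mul, hsum, hsumlam, one_mul]
    simp only [h1, h2]
    exact tendsto_finsetSum _ fun ξ _ => (hUlim ξ j _ _ ((he ξ).measurable ((hA a).prod .univ))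
      ((he ξ).measurable ((hA b).prod .univ))).const_mul _

/-- Exact limits on finitely many sets give membership at some late time; agreement with `T₀` on
more and more sets with shrinking error gives weak convergence to `T₀`. -/
theorem dense_approxSet {N : ℕ} {φ : Fin N → ℕ → ℤ} {lam : Fin N → ℝ}
    (hlam : ∀ j, lam j ∈ Set.Icc (0 : ℝ) 1) {n : ℕ → ℕ} (hC : ConditionC φ n) {A : ℕ → Set I}
    (hA : ∀ a, MeasurableSet (A a))
    (hAd : ∀ B, MeasurableSet B → ∀ ε > 0, ∃ a, volume.real (symmDiff B (A a)) < ε) (r : ℕ) :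
    Dense (approxSet (fun j k => φ j (n k)) lam A r) := by
  intro T₀
  have h : ∀ m : ℕ, ∃ T ∈ approxSet (fun j k => φ j (n k)) lam A r, ∀ a < m, ∀ b < m,
      |T.interMeasure (A a) (A b) - T₀.interMeasure (A a) (A b)| < 1 / (m + 1) := by
    intro m
    obtain ⟨T, hT, hTlim⟩ := exists_close_tendsto_mixLimit hlam hC hA (max m r)
      (show (0 : ℝ) < 1 / (m + 1) / 2 by positivity) T₀
    refine ⟨T, ?_, fun a ha b hb => (hT a (lt_max_of_lt_left ha) b (lt_max_of_lt_left hb)).trans_lt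
      (half_lt_self (by positivity))⟩
    have h1 : ∀ᶠ k in atTop, ∀ j, ∀ a ∈ Set.Iio r, ∀ b ∈ Set.Iio r,
        |(T ^ φ j (n k)).interMeasure (A a) (A b) - mixLimit (lam j) (A a) (A b)| <
          1 / (r + 1) := by
      refine eventually_all.2 fun j => (Set.finite_Iio r).eventually_all.2 fun a ha =>
        (Set.finite_Iio r).eventually_all.2 fun b hb => ?_
      exact Metric.tendsto_nhds.1 (hTlim j a (lt_max_of_lt_right ha) b (lt_max_of_lt_right hb))
        (1 / (r + 1)) (by positivity)
    obtain ⟨k, hk, hkr⟩ := (h1.and (eventually_ge_atTop r)).exists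
    exact ⟨k, hkr, hk⟩
  choose T hT hT₀ using h
  refine mem_closure_of_tendsto (tendsto_nhds_of_interMeasure (l := atTop) (u := T) ?_)
    (.of_forall hT)
  intro B B' hB hB'
  exact tendsto_of_tendsto_dense_seq hA hAd (G := T₀.interMeasure)
    (fun l => abs_interMeasure_sub_le (T l)) (abs_interMeasure_sub_le T₀)
    (tendsto_of_forall_lt_abs_sub_lt (F := fun l => (T l).interMeasure) hT₀) hB hB'

end Aut01

end

theorem theorem0 {N : ℕ} (φ : Fin N → ℕ → ℤ) (lam : Fin N → ℝ)
    (hlam : ∀ j, lam j ∈ Set.Icc (0 : ℝ) 1) (n : ℕ → ℕ) (hC : ConditionC φ n) :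
    Dense (interpolationSet φ n lam) ∧ IsGδ (interpolationSet φ n lam) := by
  obtain ⟨A, hA, hAd⟩ := Aut01.exists_dense_seq_measurableSet
  rw [Aut01.interpolationSet_eq_iInter φ n hlam hA hAd]
  exact ⟨dense_iInter_of_isOpen (Aut01.isOpen_approxSet _ lam hA)
      (Aut01.dense_approxSet hlam hC hA hAd),
    .iInter_of_isOpen (Aut01.isOpen_approxSet _ lam hA)⟩
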